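/- Let $\Sigma$ be a signature (a set of symbols $f$, each with a fixed arity in $\mathbb N$), $\mathcal X$ an infinite set of variables, and $T$ the set of finite and infinite terms over $\Sigma$ and $\mathcal X$, with the metric $d(s,t)=2^{-n}$ for $s\neq t$, where $n$ is the first level at which $s$ and $t$ differ. A TRS $\mathcal R$ over $\Sigma$ and $\mathcal X$ is a set of rules $\ell\to r$ with $\ell,r\in T$ possibly infinite, $\ell$ not a variable, and every variable of $r$ occurring in $\ell$. Write $\to_\varepsilon\;=\{(\ell\sigma,r\sigma)\mid \ell\to r\in\mathcal R,\ \sigma:\mathcal X\to T\}$ for its root steps and $\to$ for its rewrite relation, that is, the closure of $\to_\varepsilon$ under contexts $C[\cdot]$ (with exactly one hole). For $Q\subseteq T\times T$: * $E(Q)$ is the equivalence closure of $Q$; * a step of $Q$ at position $p$ is a pair $(C[s'],C[t'])$ where $s'\mathrel Q t'$ and the hole of the context $C$ is at position $p$; * $s\mathrel{S(Q)}t$ holds if there are an ordinal $\alpha$ and terms $(t_\beta)_{\beta\le\alpha}$ with $t_0=s$, $t_\alpha=t$, such that for every $\beta<\alpha$ there is a step of $Q$ from $t_\beta$ to $t_{\beta+1}$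 at some chosen position $p_\beta$, and for every limit ordinal $\lambda\le\alpha$, as $\beta$ tends to $\lambda$ from below, $d(t_\beta,t_\lambda)\to 0$ and $|p_\beta|\to\infty$ (strong convergence); * $S_E(Q)=(S\circ E)^*(Q)=\bigcup_{n\in\mathbb N}(S\circ E)^n(Q)$; * $\overline{Q}=\{(f(s_1,\ldots,s_n),f(t_1,\ldots,t_n))\mid f\in\Sigma,\ s_1\mathrel Q t_1,\ldots,s_n\mathrel Q t_n\}\cup\mathrm{id}$. Infinitary equational reasoning $=^\infty$ is the greatest fixed point of $Q\mapsto(\leftarrow_\varepsilon\cup\to_\varepsilon\cup\;\overline{Q})^*$. **Lemma.** (i) For every TRS, $S_E(\to)\subseteq{=^\infty}$. (ii) The inclusion is strict for the TRS over the unary symbols $g,a_i,b_i,f_i$ ($i\in\mathbb N$) and the constant $\varepsilon$ with the rules (for all $i\in\mathbb N$) $$g(b_i(\varepsilon))\to g(g(a_{i+1}(\varepsilon))),\quad a_0(\varepsilon)\to f_0(a_0(\varepsilon)),\quad b_0(\varepsilon)\to f_0(b_0(\varepsilon)),$$ $$a_{i+1}(\varepsilon)\to a_{i+1}(a_i(\varepsilon)),\quad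 b_{i+1}(\varepsilon)\to b_{i+1}(b_i(\varepsilon)),$$ $$a_{i+1}(b_i(\varepsilon))\to f_{i+1}(a_{i+1}(\varepsilon)),\quad b_{i+1}(a_i(\varepsilon))\to f_{i+1}(b_{i+1}(\varepsilon)).$$ Indeed $g(a_0(\varepsilon))=^\infty g^\omega$, where $g^\omega=g(g(g(\cdots)))$, but $g(a_0(\varepsilon))\mathrel{S_E(\to)}g^\omega$ does not hold. (iii) The inclusion is also strict for the TRS with the finitely many symbols $g,s$ (unary), $a,b,f$ (binary), $0,\varepsilon$ (constants) and the seven rules, where $x\in\mathcal X$, $$g(b(x,\varepsilon))\to g(g(a(s(x),\varepsilon))),\quad a(0,\varepsilon)\to f(0,a(0,\varepsilon)),\quad b(0,\varepsilon)\to f(0,b(0,\varepsilon)),$$ $$a(s(x),\varepsilon)\to a(s(x),a(x,\varepsilon)),\quad b(s(x),\varepsilon)\to b(s(x),b(x,\varepsilon)),$$ $$a(s(x),b(x,\varepsilon))\to f(s(x),a(s(x),\varepsilon)),\quad b(s(x),a(x,\varepsilon))\to f(s(x),b(s(x),\varepsilon)).$$ Indeed $g(a(0,\varepsilon))=^\infty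 g^\omega$, but $g(a(0,\varepsilon))\mathrel{S_E(\to)}g^\omega$ does not hold. -/

import Mathlib

open Filter Topology

universe u v

namespace InfTRS

/-- A signature: a set of symbols, each with a fixed finite arity. -/
structure Signature where
  Sym : Type u
  arity : Sym → ℕ

/-- The shape of one level of a term over `S` and `X`: a variable (no arguments), or a symbol
with as many arguments as its arity. -/
def shape (S : Signature.{u}) (X : Type v) : PFunctor.{max u v, 0} where
  A := X ⊕ S.Sym
  B := Sum.elim (fun _ => Empty) (fun f => Fin (S.arity f))

/-- Finite and infinite terms over the signature `S` and the variables `X`: the final coalgebra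
of `shape S X`, so that equality of terms is bisimilarity. -/
def Term (S : Signature.{u}) (X : Type v) : Type (max u v) := (shape S X).M

variable {S : Signature.{u}} {X : Type v}

namespace Term

/-- The root symbol or variable of a term, with the arguments. -/
def dest (t : Term S X) : shape S X (Term S X) := PFunctor.M.dest t

/-- The variable `x` as a term. -/
def var (x : X) : Term S X := PFunctor.M.mk ⟨Sum.inl x, Empty.elim⟩

/-- The term `f(t₁, …, tₙ)`. -/
def node (f : S.Sym) (ts : Fin (S.arity f) → Term S X) : Term S X :=
  PFunctor.M.mk ⟨Sum.inr f, ts⟩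

/-- The variable `x` occurs in the term. -/
inductive Occurs (x : X) : Term S X → Prop
  | here : Occurs x (var x)
  | arg (f : S.Sym) (ts : Fin (S.arity f) → Term S X) (i : Fin (S.arity f)) :
      Occurs x (ts i) → Occurs x (node f ts)

/-- One corecursive step of substitution. A state `Sum.inl t` asks for `tσ`, while a state
`Sum.inr u` asks for a copy of `u`. -/
def substStep (σ : X → Term S X) : Term S X ⊕ Term S X → shape S X (Term S X ⊕ Term S X)
  | Sum.inl t =>
    match t.dest with
    | ⟨Sum.inl x, _⟩ => (shape S X).map Sum.inr (σ x).dest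
    | ⟨Sum.inr f, ts⟩ => ⟨Sum.inr f, fun i => Sum.inl (ts i)⟩
  | Sum.inr u => (shape S X).map Sum.inr u.dest

/-- The term `tσ`, by corecursion: `xσ = σ x` and `f(t₁, …, tₙ)σ = f(t₁σ, …, tₙσ)`. -/
def subst (σ : X → Term S X) (t : Term S X) : Term S X :=
  PFunctor.M.corec (substStep σ) (Sum.inl t)

/-- The first level at which the two (distinct) terms differ. The approximation `approx (n + 1)`
of a term consists of the levels `0, …, n` of the tree. -/
noncomputable def firstDiff (s t : Term S X) : ℕ :=
  sInf {n : ℕ | PFunctor.MIntl.approx s (n + 1) ≠ PFunctor.MIntl.approx t (n + 1)}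

open Classical in
/-- The metric on terms: `0` for equal terms, and otherwise `2⁻ⁿ` where `n` is the first level
at which they differ. -/
noncomputable def tdist (s t : Term S X) : ℝ :=
  if s = t then 0 else (1 / 2 : ℝ) ^ firstDiff s t

/-- For a unary symbol `f`, the infinite term `f^ω = f(f(f(…)))`. -/
def omega (f : S.Sym) : Term S X :=
  PFunctor.M.corec (fun _ : Unit => (⟨Sum.inr f, fun _ => ()⟩ : shape S X Unit)) ()

theorem dest_var (x : X) : (var x : Term S X).dest = ⟨Sum.inl x, Empty.elim⟩ := rfl

theorem dest_node (f : S.Sym) (ts : Fin (S.arity f) → Term S X) :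
    (node f ts).dest = ⟨Sum.inr f, ts⟩ := rfl

theorem node_ne_var (f : S.Sym) (ts : Fin (S.arity f) → Term S X) (x : X) :
    node f ts ≠ var x := by
  intro h
  have h' := congrArg (fun t => (dest t).1) h
  simp only [dest_var, dest_node] at h'
  cases h'

theorem occurs_node {x : X} {f : S.Sym} {ts : Fin (S.arity f) → Term S X} :
    Occurs x (node f ts) ↔ ∃ i, Occurs x (ts i) := by
  constructor
  · intro h
    generalize ht : node f ts = t at h
    cases h with
    | here => exact absurd ht (node_ne_var f ts x)
    | arg g us i hi =>
      have h' := congrArg dest ht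
      rw [dest_node, dest_node] at h'
      cases h'
      exact ⟨i, hi⟩
  · rintro ⟨i, hi⟩
    exact Occurs.arg f ts i hi

end Term

open Term

/-- Contexts, that is, terms with precisely one hole. In `arg f ts i C` the hole is in the `i`-th
argument of `f`, which is `C` (the entry `ts i` is ignored); the other arguments are given by
`ts`. -/
inductive Context (S : Signature.{u}) (X : Type v) : Type (max u v)
  | hole : Context S X
  | arg (f : S.Sym) (ts : Fin (S.arity f) → Term S X) (i : Fin (S.arity f)) (C : Context S X) :
      Context S X

namespace Context

/-- The term `C[s]`. -/
def fill : Context S X → Term S X → Term S X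
  | hole, s => s
  | arg f ts i C, s => node f (Function.update ts i (C.fill s))

/-- The position of the hole (arguments are counted from `0`). -/
def pos : Context S X → List ℕ
  | hole => []
  | arg _ _ i C => (i : ℕ) :: C.pos

end Context

/-- A term rewriting system: a set of pairs `(ℓ, r)` of possibly infinite terms such that `ℓ` is
not a variable and every variable of `r` occurs in `ℓ`. -/
structure TRS (S : Signature.{u}) (X : Type v) where
  rules : Set (Term S X × Term S X)
  lhs_not_var : ∀ ρ ∈ rules, ∀ x : X, ρ.1 ≠ var x
  vars_subset : ∀ ρ ∈ rules, ∀ x : X, Occurs x ρ.2 → Occurs x ρ.1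

/-- Binary relations on terms. -/
abbrev TRel (S : Signature.{u}) (X : Type v) := Term S X → Term S X → Prop

/-- Root steps `ℓσ →_ε rσ`. -/
def TRS.rootStep (R : TRS S X) : TRel S X := fun s t =>
  ∃ ρ ∈ R.rules, ∃ σ : X → Term S X, s = ρ.1.subst σ ∧ t = ρ.2.subst σ

/-- A step of the relation `Q` at position `p`: `C[s'] → C[t']` where `s' Q t'` and the hole of
the context `C` is at position `p`. -/
def StepAt (Q : TRel S X) (p : List ℕ) : TRel S X := fun s t =>
  ∃ (C : Context S X) (s' t' : Term S X), C.pos = p ∧ Q s' t' ∧ s = C.fill s' ∧ t = C.fill t'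

/-- The rewrite relation `→` of a term rewriting system. -/
def TRS.step (R : TRS S X) : TRel S X := fun s t => ∃ p, StepAt R.rootStep p s t

/-- The strongly convergent transfinite sequences `t` of length `α` of steps of `Q`, the `β`-th
step `t β → t (β + 1)` being at position `p β`: at every limit ordinal `l ≤ α` the terms `t β`
converge to `t l` and the depths of the steps tend to infinity, as `β` tends to `l` from below. -/
structure StronglyConvergent (Q : TRel S X) (α : Ordinal.{0}) (t : Ordinal.{0} → Term S X)
    (p : Ordinal.{0} → List ℕ) : Prop where
  step : ∀ β < α, StepAt Q (p β) (t β) (t (β + 1))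
  dist_tendsto : ∀ l ≤ α, Order.IsSuccLimit l →
    Tendsto (fun β => tdist (t β) (t l)) (𝓝[<] l) (𝓝 0)
  depth_tendsto : ∀ l ≤ α, Order.IsSuccLimit l →
    Tendsto (fun β => (p β).length) (𝓝[<] l) atTop

/-- The strongly convergent rewrite relation `S(Q)` with single steps from `Q`. A strongly
convergent sequence has only finitely many steps at each depth, hence countable length, so that
the ordinals in `Ordinal.{0}` are enough in every universe. -/
def strongClosure (Q : TRel S X) : TRel S X := fun s s' =>
  ∃ (α : Ordinal.{0}) (t : Ordinal.{0} → Term S X) (p : Ordinal.{0} → List ℕ),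
    StronglyConvergent Q α t p ∧ t 0 = s ∧ t α = s'

/-- The equivalence closure `E(Q)`. -/
def equivClosure (Q : TRel S X) : TRel S X := Relation.EqvGen Q

/-- The closure `S_E(Q) = (S ∘ E)^*(Q)`, the union of the relations `(S ∘ E)ⁿ(Q)`, `n ∈ ℕ`. -/
def SE (Q : TRel S X) : TRel S X := fun s t =>
  ∃ n : ℕ, (fun P : TRel S X => strongClosure (equivClosure P))^[n] Q s t

/-- The lifting of a relation: `f(s₁, …, sₙ)` and `f(t₁, …, tₙ)` are related if `sᵢ Q tᵢ` for
all `i`; moreover every term is related to itself. -/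
inductive Lift (Q : TRel S X) : TRel S X
  | node (f : S.Sym) (ss ts : Fin (S.arity f) → Term S X) :
      (∀ i, Q (ss i) (ts i)) → Lift Q (Term.node f ss) (Term.node f ts)
  | refl (s : Term S X) : Lift Q s s

/-- The operator `Q ↦ (←_ε ∪ →_ε ∪ Lift Q)^*` on relations. -/
def TRS.ieqOp (R : TRS S X) : TRel S X →o TRel S X where
  toFun Q := Relation.ReflTransGen (fun s t => R.rootStep t s ∨ R.rootStep s t ∨ Lift Q s t)
  monotone' := by
    intro P Q hPQ s t h
    refine Relation.ReflTransGen.mono ?_ s t h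
    rintro a b (h | h | h)
    · exact Or.inl h
    · exact Or.inr (Or.inl h)
    · refine Or.inr (Or.inr ?_)
      cases h with
      | node f ss ts hi => exact Lift.node f ss ts (fun i => hPQ _ _ (hi i))
      | refl => exact Lift.refl _

/-- Infinitary equational reasoning `=^∞`: the coinductive reading of the rules, that is, the
greatest fixed point of the operator `Q ↦ (←_ε ∪ →_ε ∪ Lift Q)^*`. -/
def TRS.ieq (R : TRS S X) : TRel S X := OrderHom.gfp R.ieqOp

section InfiniteSystem

/-- The symbols `g`, `aᵢ`, `bᵢ`, `fᵢ` (`i ∈ ℕ`) and `ε`. -/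
inductive InfSym
  | g
  | a (i : ℕ)
  | b (i : ℕ)
  | f (i : ℕ)
  | eps

/-- The signature in which `g`, `aᵢ`, `bᵢ`, `fᵢ` are unary and `ε` is a constant. -/
abbrev infSig : Signature.{0} where
  Sym := InfSym
  arity
    | .g => 1
    | .a _ => 1
    | .b _ => 1
    | .f _ => 1
    | .eps => 0

namespace Inf

def g (t : Term infSig X) : Term infSig X := node (S := infSig) InfSym.g ![t]
def a (i : ℕ) (t : Term infSig X) : Term infSig X := node (S := infSig) (InfSym.a i) ![t]
def b (i : ℕ) (t : Term infSig X) : Term infSig X := node (S := infSig) (InfSym.b i) ![t]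
def f (i : ℕ) (t : Term infSig X) : Term infSig X := node (S := infSig) (InfSym.f i) ![t]
def eps : Term infSig X := node (S := infSig) InfSym.eps ![]

/-- The infinite term `g^ω = g(g(g(…)))`. -/
def gOmega : Term infSig X := omega (S := infSig) InfSym.g

/-- The rules of the infinite system. -/
inductive Rule : Term infSig X → Term infSig X → Prop
  | gb (i : ℕ) : Rule (g (b i eps)) (g (g (a (i + 1) eps)))
  | a_zero : Rule (a 0 eps) (f 0 (a 0 eps))
  | b_zero : Rule (b 0 eps) (f 0 (b 0 eps))
  | a_succ (i : ℕ) : Rule (a (i + 1) eps) (a (i + 1) (a i eps))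
  | b_succ (i : ℕ) : Rule (b (i + 1) eps) (b (i + 1) (b i eps))
  | ab (i : ℕ) : Rule (a (i + 1) (b i eps)) (f (i + 1) (a (i + 1) eps))
  | ba (i : ℕ) : Rule (b (i + 1) (a i eps)) (f (i + 1) (b (i + 1) eps))

theorem occurs_g (x : X) (t : Term infSig X) : Occurs x (g t) ↔ Occurs x t :=
  occurs_node.trans ⟨fun ⟨i, hi⟩ => by rw [Fin.fin_one_eq_zero i] at hi; exact hi,
    fun h => ⟨(0 : Fin 1), h⟩⟩

theorem occurs_a (x : X) (i : ℕ) (t : Term infSig X) : Occurs x (a i t) ↔ Occurs x t :=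
  occurs_node.trans ⟨fun ⟨i, hi⟩ => by rw [Fin.fin_one_eq_zero i] at hi; exact hi,
    fun h => ⟨(0 : Fin 1), h⟩⟩

theorem occurs_b (x : X) (i : ℕ) (t : Term infSig X) : Occurs x (b i t) ↔ Occurs x t :=
  occurs_node.trans ⟨fun ⟨i, hi⟩ => by rw [Fin.fin_one_eq_zero i] at hi; exact hi,
    fun h => ⟨(0 : Fin 1), h⟩⟩

theorem occurs_f (x : X) (i : ℕ) (t : Term infSig X) : Occurs x (f i t) ↔ Occurs x t :=
  occurs_node.trans ⟨fun ⟨i, hi⟩ => by rw [Fin.fin_one_eq_zero i] at hi; exact hi,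
    fun h => ⟨(0 : Fin 1), h⟩⟩

theorem Rule.lhs_not_var {l r : Term infSig X} (h : Rule l r) (x : X) : l ≠ var x := by
  cases h <;> exact node_ne_var _ _ x

theorem Rule.vars_subset {l r : Term infSig X} (h : Rule l r) (x : X) (hx : Occurs x r) :
    Occurs x l := by
  cases h <;> simpa only [occurs_g, occurs_a, occurs_b, occurs_f] using hx

/-- The infinite system. -/
def sys (X : Type v) : TRS infSig X where
  rules := {ρ | Rule ρ.1 ρ.2}
  lhs_not_var _ h y := Rule.lhs_not_var h y
  vars_subset _ h y hy := Rule.vars_subset h y hy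

end Inf

end InfiniteSystem

section FiniteSystem

/-- The symbols `g`, `a`, `b`, `f`, `s`, `0` and `ε`. -/
inductive FinSym
  | g
  | a
  | b
  | f
  | s
  | zero
  | eps

/-- The signature in which `g`, `s` are unary, `a`, `b`, `f` are binary, and `0`, `ε` are
constants. -/
abbrev finSig : Signature.{0} where
  Sym := FinSym
  arity
    | .g => 1
    | .a => 2
    | .b => 2
    | .f => 2
    | .s => 1
    | .zero => 0
    | .eps => 0

namespace Fini

def g (t : Term finSig X) : Term finSig X := node (S := finSig) FinSym.g ![t]
def a (n t : Term finSig X) : Term finSig X := node (S := finSig) FinSym.a ![n, t]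
def b (n t : Term finSig X) : Term finSig X := node (S := finSig) FinSym.b ![n, t]
def f (n t : Term finSig X) : Term finSig X := node (S := finSig) FinSym.f ![n, t]
def s (t : Term finSig X) : Term finSig X := node (S := finSig) FinSym.s ![t]
def zero : Term finSig X := node (S := finSig) FinSym.zero ![]
def eps : Term finSig X := node (S := finSig) FinSym.eps ![]

/-- The infinite term `g^ω = g(g(g(…)))`. -/
def gOmega : Term finSig X := omega (S := finSig) FinSym.g

/-- The seven rules of the finite system, written with the variable `x`. -/
inductive Rule (x : X) : Term finSig X → Term finSig X → Prop
  | gb : Rule x (g (b (var x) eps)) (g (g (a (s (var x)) eps)))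
  | a_zero : Rule x (a zero eps) (f zero (a zero eps))
  | b_zero : Rule x (b zero eps) (f zero (b zero eps))
  | a_succ : Rule x (a (s (var x)) eps) (a (s (var x)) (a (var x) eps))
  | b_succ : Rule x (b (s (var x)) eps) (b (s (var x)) (b (var x) eps))
  | ab : Rule x (a (s (var x)) (b (var x) eps)) (f (s (var x)) (a (s (var x)) eps))
  | ba : Rule x (b (s (var x)) (a (var x) eps)) (f (s (var x)) (b (s (var x)) eps))

theorem not_occurs_eps (x : X) : ¬ Occurs x (eps : Term finSig X) := by
  intro h
  obtain ⟨i, -⟩ := occurs_node.1 h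
  exact Fin.elim0 i

theorem occurs_g (x : X) (t : Term finSig X) : Occurs x (g t) ↔ Occurs x t :=
  occurs_node.trans ⟨fun ⟨i, hi⟩ => by rw [Fin.fin_one_eq_zero i] at hi; exact hi,
    fun h => ⟨(0 : Fin 1), h⟩⟩

theorem occurs_s (x : X) (t : Term finSig X) : Occurs x (s t) ↔ Occurs x t :=
  occurs_node.trans ⟨fun ⟨i, hi⟩ => by rw [Fin.fin_one_eq_zero i] at hi; exact hi,
    fun h => ⟨(0 : Fin 1), h⟩⟩

theorem occurs_a (x : X) (n t : Term finSig X) :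
    Occurs x (a n t) ↔ Occurs x n ∨ Occurs x t :=
  occurs_node.trans (Fin.exists_fin_two (p := fun i => Occurs x (![n, t] i)))

theorem occurs_b (x : X) (n t : Term finSig X) :
    Occurs x (b n t) ↔ Occurs x n ∨ Occurs x t :=
  occurs_node.trans (Fin.exists_fin_two (p := fun i => Occurs x (![n, t] i)))

theorem occurs_f (x : X) (n t : Term finSig X) :
    Occurs x (f n t) ↔ Occurs x n ∨ Occurs x t :=
  occurs_node.trans (Fin.exists_fin_two (p := fun i => Occurs x (![n, t] i)))

theorem Rule.lhs_not_var {x : X} {l r : Term finSig X} (h : Rule x l r) (y : X) :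
    l ≠ var y := by
  cases h <;> exact node_ne_var _ _ y

theorem Rule.vars_subset {x : X} {l r : Term finSig X} (h : Rule x l r) (y : X)
    (hy : Occurs y r) : Occurs y l := by
  cases h <;>
    simpa only [occurs_g, occurs_a, occurs_b, occurs_f, occurs_s, not_occurs_eps, or_false,
      or_self] using hy

/-- The finite system, whose rules are written with the variable `x`. -/
def sys (x : X) : TRS finSig X where
  rules := {ρ | Rule x ρ.1 ρ.2}
  lhs_not_var _ h y := Rule.lhs_not_var h y
  vars_subset _ h y hy := Rule.vars_subset h y hy

end Fini

end FiniteSystem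

end InfTRS

/-! Inclusion. It suffices that `=^∞` is closed under strongly convergent sequences of its own
steps. Before a limit such a sequence has a tail without root steps, and this tail splits into
strongly convergent sequences between the arguments (`DeepClosure.lift`). Hence these sequences form
a post-fixed point of the operator (`deepClosure_ieq_le_ieq`).

The equation. Write Aᵢ = aᵢ(ε) and Bᵢ = bᵢ(ε). Both A₀ and B₀ unfold to f₀^ω. If Aᵢ =^∞ Bᵢ, then
Aᵢ₊₁ = aᵢ₊₁(Aᵢ) = aᵢ₊₁(Bᵢ) = fᵢ₊₁(Aᵢ₊₁), and symmetrically for Bᵢ₊₁, so both are fᵢ₊₁^ω. Thus g(Aᵢ)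
= g(Bᵢ) = g(g(Aᵢ₊₁)), and coinduction yields g^ω (`ieq_omega_of_rules`). The arguments for Aᵢ = Bᵢ
are nested ever deeper as i grows, whereas `SE` allows only a finite number of levels.

Non-membership in `SE`. Terms are read as words, with three invariants: the colour `Col`, the count
`Cnt` and the potential `Low`. Root steps in both directions preserve all of them, and the k-th
level of `SE` preserves those with index at least k (`inv_iterate`). A limit can destroy the colour
at i by producing fᵢ^ω. But if single steps preserve colours and counts from index k on, then along
a convergent sequence the counts can only drop: the prefix of letters fᵢ₊₁ stays bounded and the
colour at i+1 survives. So each level loses one index only. `Low K` is preserved by g bᵢ → g g aᵢ₊₁,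
because one more g is paid for by a larger index; it holds for g a₀ and never for g^ω.

The finite system reduces to the same words: a numeral is `=^∞` only to itself
(`eq_numeral_of_ieq`), so a numeral as first argument acts as a fixed index. -/

namespace InfTRS

variable {S : Signature.{u}} {X : Type v}

open Term

/-! ### Terms: case analysis, substitution, agreement up to a level -/

namespace Term

theorem eq_var_or_node (t : Term S X) : (∃ x, t = var x) ∨ ∃ f ts, t = node f ts := by
  induction t using PFunctor.M.casesOn' with
  | _ a ts =>
    cases a with
    | inl x =>
      refine Or.inl ⟨x, ?_⟩
      unfold var
      congr
      funext i
      exact Empty.elim i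
    | inr f => exact Or.inr ⟨f, ts, rfl⟩

theorem node_inj {f : S.Sym} {ss ts : Fin (S.arity f) → Term S X} (h : node f ss = node f ts) :
    ss = ts := by
  have h' := congrArg dest h
  rw [dest_node, dest_node] at h'
  cases h'
  rfl

theorem node_sym_inj {f g : S.Sym} {ss : Fin (S.arity f) → Term S X}
    {ts : Fin (S.arity g) → Term S X} (h : node f ss = node g ts) : f = g := by
  have h' := congrArg (fun t => (dest t).1) h
  simp only [dest_node] at h'
  exact Sum.inr_injective h'

theorem subst_var (σ : X → Term S X) (x : X) : (var x).subst σ = σ x := by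
  have copy : ∀ u : Term S X, PFunctor.M.corec (substStep σ) (Sum.inr u) = u := by
    intro u
    refine PFunctor.M.bisim
      (fun s t => s = PFunctor.M.corec (substStep σ) (Sum.inr t)) ?_ _ _ rfl
    rintro _ t rfl
    rcases ht : PFunctor.M.dest t with ⟨a, ts⟩
    refine ⟨a, fun i => PFunctor.M.corec (substStep σ) (Sum.inr (ts i)), ts, ?_, rfl, fun _ => rfl⟩
    rw [PFunctor.M.dest_corec]
    have : substStep σ (Sum.inr t) = ⟨a, fun i => Sum.inr (ts i)⟩ := by
      change (shape S X).map Sum.inr (PFunctor.M.dest t) = _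
      rw [ht]
      rfl
    rw [this]
    rfl
  rw [← PFunctor.M.mk_dest (subst σ (var x)), ← PFunctor.M.mk_dest (σ x)]
  congr 1
  unfold subst
  rw [PFunctor.M.dest_corec]
  change (shape S X).map _ ((shape S X).map Sum.inr (PFunctor.M.dest (σ x))) = _
  rcases PFunctor.M.dest (σ x) with ⟨a, ts⟩
  change (⟨a, fun i => PFunctor.M.corec (substStep σ) (Sum.inr (ts i))⟩ : shape S X _) = _
  exact congrArg (fun us => (⟨a, us⟩ : shape S X (Term S X))) (funext fun i => copy (ts i))

theorem subst_node (σ : X → Term S X) (f : S.Sym) (ts : Fin (S.arity f) → Term S X) :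
    (node f ts).subst σ = node f (fun i => (ts i).subst σ) := by
  unfold subst
  rw [PFunctor.M.corec_def]
  rfl

theorem omega_eq (f : S.Sym) : (omega f : Term S X) = node f (fun _ => omega f) := by
  exact (PFunctor.M.corec_def (F := shape S X) _ _).trans rfl

/-- The two terms coincide on the levels `0, …, n - 1`. -/
def Agree : ℕ → Term S X → Term S X → Prop
  | 0, _, _ => True
  | n + 1, s, t => s = t ∨ ∃ f ss ts, s = node f ss ∧ t = node f ts ∧ ∀ i, Agree n (ss i) (ts i)

theorem agree_of_approx_eq {n : ℕ} {s t : Term S X}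
    (h : PFunctor.MIntl.approx s n = PFunctor.MIntl.approx t n) : Agree n s t := by
  induction n generalizing s t with
  | zero => trivial
  | succ n ih =>
    rcases eq_var_or_node s with ⟨x, rfl⟩ | ⟨f, ss, rfl⟩ <;>
      rcases eq_var_or_node t with ⟨y, rfl⟩ | ⟨g, ts, rfl⟩
    · have := (PFunctor.Approx.CofixA.intro.inj h).1
      rw [Sum.inl_injective this]
      exact Or.inl rfl
    · cases (PFunctor.Approx.CofixA.intro.inj h).1
    · cases (PFunctor.Approx.CofixA.intro.inj h).1
    · obtain ⟨h1, h2⟩ := PFunctor.Approx.CofixA.intro.inj h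
      cases Sum.inr_injective h1
      exact Or.inr ⟨f, ss, ts, rfl, rfl, fun i => ih (congrFun (eq_of_heq h2) i)⟩

theorem agree_of_tdist_lt {n : ℕ} {s t : Term S X} (h : tdist s t < (1 / 2 : ℝ) ^ n) :
    Agree n s t := by
  by_cases hst : s = t
  · subst hst
    exact agree_of_approx_eq rfl
  · cases n with
    | zero => trivial
    | succ n =>
      rw [tdist, if_neg hst, pow_lt_pow_iff_right_of_lt_one₀ (by norm_num) (by norm_num)] at h
      refine agree_of_approx_eq ?_
      by_contra hn
      have : firstDiff s t ≤ n := Nat.sInf_le hn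
      omega

end Term

/-! ### Strongly convergent sequences and their arguments -/

/-- Transfinite induction along the ordinals of a closed interval. -/
theorem ordinal_Icc_induction {γ α : Ordinal.{0}} {P : Ordinal.{0} → Prop} (base : P γ)
    (succ : ∀ β, γ ≤ β → β < α → P β → P (β + 1))
    (lim : ∀ l, γ < l → l ≤ α → Order.IsSuccLimit l → (∀ β, γ ≤ β → β < l → P β) → P l) :
    ∀ β, γ ≤ β → β ≤ α → P β := by
  intro β
  induction β using Ordinal.limitRecOn with
  | zero =>
    intro h _
    rwa [← nonpos_iff_eq_zero.1 h]
  | add_one β ih =>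
    intro h h'
    rcases h.eq_or_lt with rfl | h
    · exact base
    · have h1 : γ ≤ β := Order.lt_add_one_iff.1 h
      have h2 : β < α := Order.add_one_le_iff.1 h'
      exact succ β h1 h2 (ih h1 h2.le)
  | limit l hl ih =>
    intro h h'
    rcases h.eq_or_lt with rfl | h
    · exact base
    · exact lim l h h' hl fun β h1 h2 => ih β h2 h1 (h2.le.trans h')

/-- A sequence of terms, indexed by the ordinals from `γ` to `α`, in which every step is trivial
or a step of `Q` of depth at least `d β ≥ n`, and which is strongly convergent. -/
structure ConvergentSegment (Q : TRel S X) (n : ℕ) (γ α : Ordinal.{0})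
    (t : Ordinal.{0} → Term S X) (d : Ordinal.{0} → ℕ) : Prop where
  le : γ ≤ α
  step : ∀ β, γ ≤ β → β < α →
    t β = t (β + 1) ∨ ∃ p, d β ≤ p.length ∧ StepAt Q p (t β) (t (β + 1))
  depth : ∀ β, γ ≤ β → β < α → n ≤ d β
  lim : ∀ l, γ < l → l ≤ α → Order.IsSuccLimit l → ∀ m, ∃ δ, γ ≤ δ ∧ δ < l ∧
    ∀ β, δ ≤ β → β < l → m ≤ d β ∧ Agree m (t β) (t l)

/-- The strongly convergent closure with steps of depth at least `n`. -/
def DeepClosure (Q : TRel S X) (n : ℕ) : TRel S X := fun s s' =>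
  ∃ γ α t d, ConvergentSegment Q n γ α t d ∧ t γ = s ∧ t α = s'

theorem DeepClosure.mono_depth {Q : TRel S X} {m n : ℕ} (h : m ≤ n) {s t : Term S X}
    (hst : DeepClosure Q n s t) : DeepClosure Q m s t := by
  obtain ⟨γ, α, t, d, hs, rfl, rfl⟩ := hst
  exact ⟨γ, α, t, d, ⟨hs.le, hs.step, fun β h1 h2 => h.trans (hs.depth β h1 h2), hs.lim⟩, rfl, rfl⟩

theorem DeepClosure.refl {Q : TRel S X} {n : ℕ} (s : Term S X) : DeepClosure Q n s s :=
  ⟨0, 0, fun _ => s, fun _ => n, ⟨le_rfl, fun _ _ _ => Or.inl rfl, fun _ _ _ => le_rfl,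
    fun _ h h' => absurd h h'.not_gt⟩, rfl, rfl⟩

theorem DeepClosure.of_rel {Q : TRel S X} {s t : Term S X} (h : Q s t) : DeepClosure Q 0 s t := by
  refine ⟨0, 1, fun β => if β = 0 then s else t, fun _ => 0, ⟨zero_le_one, ?_, fun _ _ _ => le_rfl,
    ?_⟩, by simp, by simp⟩
  · intro β _ hβ
    obtain rfl : β = 0 := by simpa using hβ
    refine Or.inr ⟨[], le_rfl, .hole, s, t, rfl, h, ?_, ?_⟩ <;> simp [Context.fill]
  · intro l h1 h2 hl
    have : (0 : Ordinal) + 1 < l := hl.add_one_lt h1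
    rw [zero_add] at this
    exact absurd h2 this.not_ge

theorem strongClosure_le_deepClosure {Q : TRel S X} : strongClosure Q ≤ DeepClosure Q 0 := by
  rintro _ _ ⟨α, t, p, h, rfl, rfl⟩
  refine ⟨0, α, t, fun β => (p β).length, ⟨zero_le, fun β _ hβ => Or.inr ⟨p β, le_rfl,
    h.step β hβ⟩, fun _ _ _ => Nat.zero_le _, ?_⟩, rfl, rfl⟩
  intro l h0 hl hlim m
  have h1 := (h.depth_tendsto l hl hlim).eventually_ge_atTop m
  have h2 := (h.dist_tendsto l hl hlim).eventually_lt_const (show (0 : ℝ) < (1 / 2) ^ m by positivity)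
  obtain ⟨δ, hδ, hsub⟩ := (mem_nhdsLT_iff_exists_Ioo_subset' h0).1 (h1.and h2)
  -- The neighbourhood is open at `δ`, whereas segments start at an included ordinal.
  refine ⟨δ + 1, zero_le, hlim.add_one_lt hδ, fun β hβ hβl => ?_⟩
  have := hsub ⟨Order.add_one_le_iff.1 hβ, hβl⟩
  exact ⟨this.1, agree_of_tdist_lt this.2⟩

/-- Induction principle for strongly convergent sequences: a preorder contains them if it contains
the single steps and is closed under limits. -/
theorem DeepClosure.induction {Q : TRel S X} {n : ℕ} {P : TRel S X} (refl : ∀ s, P s s)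
    (trans : ∀ {s t u}, P s t → P t u → P s u) (step : ∀ {p s t}, StepAt Q p s t → P s t)
    (lim : ∀ {s t}, (∀ m, ∃ u, P s u ∧ DeepClosure Q m u t) → P s t) :
    DeepClosure Q n ≤ P := by
  rintro _ _ ⟨γ, α, t, d, h, rfl, rfl⟩
  refine ordinal_Icc_induction (P := fun β => P (t γ) (t β)) (refl _) ?_ ?_ α h.le le_rfl
  · intro β h1 h2 ih
    rcases h.step β h1 h2 with heq | ⟨p, -, hp⟩
    · rwa [← heq]
    · exact trans ih (step hp)
  · intro l h1 h2 hl ih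
    refine lim fun m => ?_
    obtain ⟨δ, hγδ, hδl, hδ⟩ := h.lim l h1 h2 hl m
    refine ⟨t δ, ih δ hγδ hδl, δ, l, t, d, ⟨hδl.le, fun β h3 h4 => h.step β (hγδ.trans h3)
      (h4.trans_le h2), fun β h3 h4 => (hδ β h3 h4).1, ?_⟩, rfl, rfl⟩
    intro l' h3 h4 hl' m'
    obtain ⟨δ', h5, h6, h7⟩ := h.lim l' (hγδ.trans_lt h3) (h4.trans h2) hl' m'
    exact ⟨max δ δ', le_max_left _ _, max_lt h3 h6, fun β h8 h9 => h7 β ((le_max_right _ _).trans h8) h9⟩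

theorem StepAt.node_cases {Q : TRel S X} {p : List ℕ} {s t : Term S X} (h : StepAt Q p s t)
    (hp : 0 < p.length) : ∃ f ss ts, s = node f ss ∧ t = node f ts ∧
      ∀ i, ss i = ts i ∨ ∃ q, q.length + 1 = p.length ∧ StepAt Q q (ss i) (ts i) := by
  obtain ⟨C, s', t', rfl, hQ, rfl, rfl⟩ := h
  cases C with
  | hole => simp [Context.pos] at hp
  | arg f ts i C =>
    refine ⟨f, _, _, rfl, rfl, fun j => ?_⟩
    by_cases hj : j = i
    · subst hj
      refine Or.inr ⟨C.pos, by simp [Context.pos], C, s', t', rfl, hQ, ?_, ?_⟩ <;> simp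
    · left
      simp [hj]

/-- A strongly convergent sequence without root steps runs inside the arguments. -/
theorem DeepClosure.lift {Q : TRel S X} {n : ℕ} {s t : Term S X}
    (h : DeepClosure Q (n + 1) s t) : Lift (DeepClosure Q n) s t := by
  obtain ⟨γ, α, t, d, h, rfl, rfl⟩ := h
  have hd : ∀ β, γ ≤ β → β < α → ∀ p : List ℕ, d β ≤ p.length → 0 < p.length :=
    fun β h1 h2 p hp => (Nat.succ_pos n).trans_le ((h.depth β h1 h2).trans hp)
  rcases eq_var_or_node (t γ) with ⟨x, hx⟩ | ⟨f, ts, hf⟩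
  -- A variable has no position below the root, so the sequence is constant.
  · have : ∀ β, γ ≤ β → β ≤ α → t β = var x := by
      refine ordinal_Icc_induction hx ?_ ?_
      · intro β h1 h2 ih
        rcases h.step β h1 h2 with heq | ⟨p, hp, hs⟩
        · rwa [← heq]
        · obtain ⟨f, ss, -, hss, -⟩ := hs.node_cases (hd β h1 h2 p hp)
          exact absurd (hss.symm.trans ih) (node_ne_var _ _ _)
      · intro l h1 h2 hl ih
        obtain ⟨δ, h3, h4, h5⟩ := h.lim l h1 h2 hl 1
        rcases (h5 δ le_rfl h4).2 with heq | ⟨f, ss, -, hss, -⟩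
        · rw [← heq]
          exact ih δ h3 h4
        · exact absurd (hss.symm.trans (ih δ h3 h4)) (node_ne_var _ _ _)
    rw [this γ le_rfl h.le, this α h.le le_rfl]
    exact Lift.refl _
  · have key : ∀ β, γ ≤ β → β ≤ α → ∃ us, t β = node f us := by
      refine ordinal_Icc_induction ⟨ts, hf⟩ ?_ ?_
      · rintro β h1 h2 ⟨us, ih⟩
        rcases h.step β h1 h2 with heq | ⟨p, hp, hs⟩
        · exact ⟨us, by rw [← heq, ih]⟩
        · obtain ⟨f', ss, ts, hss, hts, -⟩ := hs.node_cases (hd β h1 h2 p hp)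
          obtain rfl := node_sym_inj (ih.symm.trans hss)
          exact ⟨ts, hts⟩
      · intro l h1 h2 hl ih
        obtain ⟨δ, h3, h4, h5⟩ := h.lim l h1 h2 hl 1
        obtain ⟨us, hus⟩ := ih δ h3 h4
        rcases (h5 δ le_rfl h4).2 with heq | ⟨f', ss, ts, hss, hts, -⟩
        · exact ⟨us, by rw [← heq, hus]⟩
        · obtain rfl := node_sym_inj (hus.symm.trans hss)
          exact ⟨ts, hts⟩
    -- The arguments are chosen for all ordinals, with the irrelevant default `ts` outside the
    -- interval.
    have key' : ∀ β, ∃ us, γ ≤ β → β ≤ α → t β = node f us := by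
      intro β
      by_cases hβ : γ ≤ β ∧ β ≤ α
      · obtain ⟨us, hus⟩ := key β hβ.1 hβ.2
        exact ⟨us, fun _ _ => hus⟩
      · exact ⟨ts, fun h1 h2 => absurd ⟨h1, h2⟩ hβ⟩
    choose us hus using key'
    rw [hus γ le_rfl h.le, hus α h.le le_rfl]
    refine Lift.node f _ _ fun i => ⟨γ, α, fun β => us β i, fun β => d β - 1,
      ⟨h.le, ?_, fun β h1 h2 => ?_, ?_⟩, rfl, rfl⟩
    · intro β h1 h2
      have e1 := hus β h1 h2.le
      have e2 := hus (β + 1) (h1.trans (Order.lt_add_one_iff.2 le_rfl).le) (Order.add_one_le_iff.2 h2)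
      rcases h.step β h1 h2 with heq | ⟨p, hp, hs⟩
      · rw [e1, e2] at heq
        exact Or.inl (congrFun (node_inj heq) i)
      · obtain ⟨f', ss, ts, hss, hts, hi⟩ := hs.node_cases (hd β h1 h2 p hp)
        rw [e1] at hss
        rw [e2] at hts
        obtain rfl := node_sym_inj hss
        obtain rfl := node_inj hss
        obtain rfl := node_inj hts
        rcases hi i with heq | ⟨q, hq, hstep⟩
        · exact Or.inl heq
        · exact Or.inr ⟨q, by omega, hstep⟩
    · have := h.depth β h1 h2
      omega
    · intro l h1 h2 hl m
      obtain ⟨δ, h3, h4, h5⟩ := h.lim l h1 h2 hl (m + 1)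
      refine ⟨δ, h3, h4, fun β h6 h7 => ?_⟩
      obtain ⟨h8, h9⟩ := h5 β h6 h7
      refine ⟨by omega, ?_⟩
      rw [hus β (h3.trans h6) (h7.le.trans h2), hus l h1.le h2] at h9
      rcases h9 with heq | ⟨f', ss, ts, hss, hts, hi⟩
      · rw [node_inj heq]
        exact agree_of_approx_eq rfl
      · obtain rfl := node_sym_inj hss
        obtain rfl := node_inj hss
        obtain rfl := node_inj hts
        exact hi i

theorem Lift.mono {P Q : TRel S X} (h : P ≤ Q) {s t : Term S X} (hst : Lift P s t) :
    Lift Q s t := by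
  cases hst with
  | node f ss ts hi => exact Lift.node f ss ts fun i => h _ _ (hi i)
  | refl => exact Lift.refl _

theorem StepAt.of_lift_le {Q P : TRel S X} (hQ : Q ≤ P) (refl : ∀ s, P s s)
    (hlift : ∀ {s t}, Lift P s t → P s t) {p : List ℕ} {s t : Term S X} (h : StepAt Q p s t) :
    P s t := by
  obtain ⟨C, s', t', -, hst, rfl, rfl⟩ := h
  induction C with
  | hole => exact hQ _ _ hst
  | arg f ts i C ih =>
    refine hlift (Lift.node f _ _ fun j => ?_)
    by_cases hj : j = i
    · subst hj
      simpa using ih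
    · simpa [hj] using refl (ts j)

/-! ### Infinitary equational reasoning and the inclusion -/

namespace TRS

variable (R : TRS S X)

theorem ieqOp_ieq : R.ieqOp R.ieq = R.ieq := R.ieqOp.isFixedPt_gfp

variable {R}

theorem ieq_of_ieqOp {s t : Term S X} (h : R.ieqOp R.ieq s t) : R.ieq s t := by
  rwa [ieqOp_ieq] at h

theorem ieq_refl (s : Term S X) : R.ieq s s := ieq_of_ieqOp Relation.ReflTransGen.refl

theorem ieq_trans {s t u : Term S X} (h1 : R.ieq s t) (h2 : R.ieq t u) : R.ieq s u := by
  rw [← ieqOp_ieq] at h1 h2 ⊢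
  exact Relation.ReflTransGen.trans h1 h2

theorem ieq_of_rootStep {s t : Term S X} (h : R.rootStep s t) : R.ieq s t :=
  ieq_of_ieqOp (Relation.ReflTransGen.single (Or.inr (Or.inl h)))

theorem ieq_of_lift {s t : Term S X} (h : Lift R.ieq s t) : R.ieq s t :=
  ieq_of_ieqOp (Relation.ReflTransGen.single (Or.inr (Or.inr h)))

/-- The operator commutes with taking converses, so the converse of `=^∞` is a post-fixed point too.
-/
theorem ieq_symm {s t : Term S X} (h : R.ieq s t) : R.ieq t s := by
  refine OrderHom.le_gfp R.ieqOp (a := fun s t => R.ieq t s) ?_ t s h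
  intro s t h
  change R.ieq t s at h
  rw [← ieqOp_ieq] at h
  have := Relation.ReflTransGen.swap _ _ h
  refine Relation.ReflTransGen.mono ?_ s t this
  rintro a b (h | h | h)
  · exact Or.inr (Or.inl h)
  · exact Or.inl h
  · refine Or.inr (Or.inr ?_)
    cases h with
    | node f ss ts hi => exact Lift.node f _ _ hi
    | refl => exact Lift.refl _

/-- Coinduction up to `=^∞` on both sides: `P ⊔ R.ieq` is a post-fixed point. -/
theorem ieq_coinduction {P : TRel S X}
    (h : ∀ s t, P s t → ∃ s' t', R.ieq s s' ∧ Lift (P ⊔ R.ieq) s' t' ∧ R.ieq t' t) :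
    P ≤ R.ieq := by
  have hle : R.ieq ≤ R.ieqOp (P ⊔ R.ieq) := by
    conv_lhs => rw [← ieqOp_ieq]
    exact R.ieqOp.monotone le_sup_right
  refine le_sup_left.trans (OrderHom.le_gfp R.ieqOp (a := P ⊔ R.ieq) ?_)
  refine sup_le ?_ hle
  intro s t hst
  obtain ⟨s', t', h1, h2, h3⟩ := h s t hst
  exact Relation.ReflTransGen.trans (hle _ _ h1) (Relation.ReflTransGen.trans (Relation.ReflTransGen.single (Or.inr (Or.inr h2))) (hle _ _ h3))

theorem ieq_of_stepAt {Q : TRel S X} (hQ : Q ≤ R.ieq) {p : List ℕ} {s t : Term S X}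
    (h : StepAt Q p s t) : R.ieq s t :=
  StepAt.of_lift_le hQ ieq_refl ieq_of_lift h

theorem equivClosure_le_ieq {Q : TRel S X} (hQ : Q ≤ R.ieq) : equivClosure Q ≤ R.ieq := by
  intro s t h
  induction h with
  | rel _ _ h => exact hQ _ _ h
  | refl => exact ieq_refl _
  | symm _ _ _ ih => exact ieq_symm ih
  | trans _ _ _ _ _ ih1 ih2 => exact ieq_trans ih1 ih2

/-- By coinduction. At a limit, the part of the sequence before some `u` is covered by the
induction, and the rest has steps of depth at least one, so it is a single lifted step. -/
theorem deepClosure_ieq_le_ieq : DeepClosure R.ieq 0 ≤ R.ieq := by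
  refine OrderHom.le_gfp R.ieqOp (DeepClosure.induction (fun _ => Relation.ReflTransGen.refl)
    (fun h1 h2 => Relation.ReflTransGen.trans h1 h2) ?_ ?_)
  · intro p s t h
    have h' := ieq_of_stepAt le_rfl h
    rw [← ieqOp_ieq] at h'
    exact R.ieqOp.monotone (fun _ _ => DeepClosure.of_rel) _ _ h'
  · intro s t h
    obtain ⟨u, hsu, hut⟩ := h 1
    exact Relation.ReflTransGen.tail hsu (Or.inr (Or.inr hut.lift))

theorem deepClosure_le_ieq {Q : TRel S X} (hQ : Q ≤ R.ieq) {n : ℕ} :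
    DeepClosure Q n ≤ R.ieq := by
  rintro _ _ ⟨γ, α, t, d, h, rfl, rfl⟩
  refine deepClosure_ieq_le_ieq _ _ ⟨γ, α, t, d, ⟨h.le, fun β h1 h2 => ?_,
    fun _ _ _ => Nat.zero_le _, h.lim⟩, rfl, rfl⟩
  refine (h.step β h1 h2).imp_right ?_
  rintro ⟨p, hp, C, s', t', hC, hst, h3⟩
  exact ⟨p, hp, C, s', t', hC, hQ _ _ hst, h3⟩

theorem step_le_ieq : R.step ≤ R.ieq := fun _ _ ⟨_, h⟩ =>
  ieq_of_stepAt (fun _ _ => ieq_of_rootStep) h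

theorem iterate_le_ieq (n : ℕ) :
    (fun P : TRel S X => strongClosure (equivClosure P))^[n] R.step ≤ R.ieq := by
  induction n with
  | zero => exact step_le_ieq
  | succ n ih =>
    rw [Function.iterate_succ_apply']
    exact strongClosure_le_deepClosure.trans (deepClosure_le_ieq (equivClosure_le_ieq ih))

theorem SE_le_ieq : SE R.step ≤ R.ieq := fun _ _ ⟨n, h⟩ => iterate_le_ieq n _ _ h

end TRS

/-! ### Words and the invariants `Col`, `Cnt`, `Low` -/

/-- The letters `g`, `aᵢ = ab true i`, `bᵢ = ab false i` and `fᵢ`. -/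
inductive Letter
  | g
  | ab (c : Bool) (i : ℕ)
  | f (i : ℕ)

/-- The index of a letter `aᵢ`, `bᵢ` or `fᵢ`. -/
def Letter.HasIndex : Letter → ℕ → Prop
  | g, _ => False
  | ab _ j, i => j = i
  | f j, i => j = i

/-- A reading of terms as words: the first letter of a term and the rest. -/
abbrev Reading (S : Signature.{u}) (X : Type v) := Term S X → Option (Letter × Term S X)

namespace Reading

variable (out : Reading S X)

/-- Both words are empty, or they have the same first letter and related rests. -/
def Zip (P : TRel S X) : TRel S X := fun s t =>
  (out s = none ∧ out t = none) ∨
    ∃ l s' t', out s = some (l, s') ∧ out t = some (l, t') ∧ P s' t'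

/-- The term is read as `fᵢ … fᵢ aᵢ …` (`c = true`) or as `fᵢ … fᵢ bᵢ …` (`c = false`). -/
inductive Col (i : ℕ) (c : Bool) : Term S X → Prop
  | ab {t t'} : out t = some (.ab c i, t') → Col i c t
  | f {t t'} : out t = some (.f i, t') → Col i c t' → Col i c t

open Classical in
/-- The term is read as `fᵢ₊₁ᵐ aᵢ₊₁ w` (`c = true`) or `fᵢ₊₁ᵐ bᵢ₊₁ w` (`c = false`), where `n = m + 1`
if `w` has the opposite colour at the index `i`, and `n = m` otherwise. -/
inductive Cnt (i : ℕ) (c : Bool) : ℕ → Term S X → Prop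
  | ab {t t'} : out t = some (.ab c (i + 1), t') → Cnt i c (if Col out i (!c) t' then 1 else 0) t
  | f {n t t'} : out t = some (.f (i + 1), t') → Cnt i c n t' → Cnt i c (n + 1) t

/-- The term is read as `gʲ w`, where the first letter of `w` has an index `i ≤ K`, `w` is of the
colour of `a` if `i = K`, and `n = j + K - i`. -/
inductive Low (K : ℕ) : ℕ → Term S X → Prop
  | base {n i l t t'} : out t = some (l, t') → l.HasIndex i → n + i = K →
      (i = K → Col out K true t) → Low K n t
  | g {n t t'} : out t = some (.g, t') → Low K n t' → Low K (n + 1) t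

variable {out}

section Equations

variable {i : ℕ} {c : Bool} {n K : ℕ} {t t' : Term S X} {l : Letter}

theorem col_iff (h : out t = some (l, t')) :
    Col out i c t ↔ l = .ab c i ∨ (l = .f i ∧ Col out i c t') := by
  constructor
  · rintro (h' | ⟨h', hc⟩) <;> cases h.symm.trans h' <;> simp [*]
  · rintro (rfl | ⟨rfl, hc⟩)
    · exact .ab h
    · exact .f h hc

theorem not_col (h : out t = none) : ¬ Col out i c t := by
  rintro (h' | ⟨h', -⟩) <;> cases h.symm.trans h'

open Classical in
theorem cnt_iff (h : out t = some (l, t')) :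
    Cnt out i c n t ↔ (l = .ab c (i + 1) ∧ n = if Col out i (!c) t' then 1 else 0) ∨
      (l = .f (i + 1) ∧ ∃ m, n = m + 1 ∧ Cnt out i c m t') := by
  constructor
  · rintro (h' | ⟨h', hc⟩) <;> cases h.symm.trans h' <;> simp [*]
  · rintro (⟨rfl, rfl⟩ | ⟨rfl, m, rfl, hc⟩)
    · exact .ab h
    · exact .f h hc

theorem not_cnt (h : out t = none) : ¬ Cnt out i c n t := by
  rintro (h' | ⟨h', -⟩) <;> cases h.symm.trans h'

theorem low_iff (h : out t = some (l, t')) :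
    Low out K n t ↔ (∃ j, l.HasIndex j ∧ n + j = K ∧ (j = K → Col out K true t)) ∨
      (l = .g ∧ ∃ m, n = m + 1 ∧ Low out K m t') := by
  constructor
  · rintro (⟨h', h1, h2, h3⟩ | ⟨h', hc⟩) <;> cases h.symm.trans h'
    · exact Or.inl ⟨_, h1, h2, h3⟩
    · exact Or.inr ⟨rfl, _, rfl, hc⟩
  · rintro (⟨j, h1, h2, h3⟩ | ⟨rfl, m, rfl, hc⟩)
    · exact .base h h1 h2 h3
    · exact .g h hc

theorem not_low (h : out t = none) : ¬ Low out K n t := by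
  rintro (⟨h', -⟩ | ⟨h', -⟩) <;> cases h.symm.trans h'

/-- With `Cnt.col`, a colour at `i + 1` amounts to the existence of a count at `i`. Thus control of
counts at `i` is control of colours at `i + 1`. -/
theorem Col.exists_cnt (h : Col out (i + 1) c t) : ∃ n, Cnt out i c n t := by
  induction h with
  | ab h => exact ⟨_, .ab h⟩
  | f h _ ih => exact ⟨_, .f h ih.choose_spec⟩

theorem Cnt.col (h : Cnt out i c n t) : Col out (i + 1) c t := by
  induction h with
  | ab h => exact .ab h
  | f h _ ih => exact .f h ih

theorem Cnt.unique {m : ℕ} (h : Cnt out i c n t) (h' : Cnt out i c m t) : n = m := by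
  induction h generalizing m with
  | ab h => simpa [cnt_iff h, eq_comm] using h'
  | f h _ ih =>
    rw [cnt_iff h] at h'
    obtain ⟨h', -⟩ | ⟨-, k, rfl, hk⟩ := h'
    · cases h'
    · rw [ih hk]

end Equations

variable (out)

/-- The invariants of the `k`-th level of `S_E`. -/
structure Inv (k : ℕ) (s t : Term S X) : Prop where
  col : ∀ i c, k ≤ i → (Col out i c s ↔ Col out i c t)
  cnt : ∀ i c n, k ≤ i → (Cnt out i c n s ↔ Cnt out i c n t)
  low : ∀ K n, k ≤ K → (Low out K n s ↔ Low out K n t)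

/-- The part of the invariants of the `k`-th level that is preserved in limits. -/
structure LimInv (k : ℕ) (s t : Term S X) : Prop where
  col : ∀ i c, k ≤ i → Col out i c t → Col out i c s
  cnt : ∀ i c n, k ≤ i → Cnt out i c n s → ∃ m ≤ n, Cnt out i c m t

variable {out}

namespace Inv

variable {k : ℕ} {s t u : Term S X}

theorem refl (s : Term S X) : Inv out k s s :=
  ⟨fun _ _ _ => Iff.rfl, fun _ _ _ _ => Iff.rfl, fun _ _ _ => Iff.rfl⟩

theorem symm (h : Inv out k s t) : Inv out k t s :=
  ⟨fun i c hi => (h.col i c hi).symm, fun i c n hi => (h.cnt i c n hi).symm,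
    fun K n hK => (h.low K n hK).symm⟩

theorem trans (h : Inv out k s t) (h' : Inv out k t u) : Inv out k s u :=
  ⟨fun i c hi => (h.col i c hi).trans (h'.col i c hi),
    fun i c n hi => (h.cnt i c n hi).trans (h'.cnt i c n hi),
    fun K n hK => (h.low K n hK).trans (h'.low K n hK)⟩

theorem mono {m : ℕ} (hm : k ≤ m) (h : Inv out k s t) : Inv out m s t :=
  ⟨fun i c hi => h.col i c (hm.trans hi), fun i c n hi => h.cnt i c n (hm.trans hi),
    fun K n hK => h.low K n (hm.trans hK)⟩

/-- Each invariant of a word is determined by its first letter and the invariants, at the same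
indices, of the rest; hence `Inv` is closed under prefixing a letter. -/
theorem of_zip (h : Zip out (Inv out k) s t) : Inv out k s t := by
  rcases h with ⟨h1, h2⟩ | ⟨l, s', t', h1, h2, h⟩
  · exact ⟨fun i c _ => iff_of_false (not_col h1) (not_col h2),
      fun i c n _ => iff_of_false (not_cnt h1) (not_cnt h2),
      fun K n _ => iff_of_false (not_low h1) (not_low h2)⟩
  · have hcol : ∀ i c, k ≤ i → (Col out i c s ↔ Col out i c t) := fun i c hi => by
      rw [col_iff h1, col_iff h2, h.col i c hi]
    refine ⟨hcol, fun i c n hi => ?_, fun K n hK => ?_⟩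
    · rw [cnt_iff h1, cnt_iff h2, h.col i (!c) hi]
      simp only [h.cnt i c _ hi]
    · rw [low_iff h1, low_iff h2]
      simp only [hcol K _ hK, h.low K _ hK]

theorem limInv (h : Inv out k s t) : LimInv out k s t :=
  ⟨fun i c hi => (h.col i c hi).2, fun i c n hi hn => ⟨n, le_rfl, (h.cnt i c n hi).1 hn⟩⟩

end Inv

namespace LimInv

variable {k : ℕ} {s t u : Term S X}

theorem refl (s : Term S X) : LimInv out k s s := (Inv.refl s).limInv

theorem trans (h : LimInv out k s t) (h' : LimInv out k t u) : LimInv out k s u := by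
  refine ⟨fun i c hi hu => h.col i c hi (h'.col i c hi hu), fun i c n hi hn => ?_⟩
  obtain ⟨m, hm, hm'⟩ := h.cnt i c n hi hn
  obtain ⟨m', h1, h2⟩ := h'.cnt i c m hi hm'
  exact ⟨m', h1.trans hm, h2⟩

/-- Backwards this is the field `col`; forwards, a count may drop but not disappear. -/
theorem col_succ_iff (h : LimInv out k s t) {i : ℕ} {c : Bool} (hi : k ≤ i) :
    Col out (i + 1) c s ↔ Col out (i + 1) c t := by
  refine ⟨fun hc => ?_, h.col _ c (hi.trans (Nat.le_succ i))⟩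
  obtain ⟨n, hn⟩ := hc.exists_cnt
  obtain ⟨m, -, hm⟩ := h.cnt i c n hi hn
  exact hm.col

end LimInv

/-! ### Behaviour of the invariants in limits -/

section Limits

variable {Q : TRel S X}
variable (hzip : ∀ {n s t}, DeepClosure Q (n + 1) s t → Zip out (DeepClosure Q n) s t)
include hzip

/-- A colour is witnessed by a finite prefix, which deep steps leave alone. -/
theorem Col.eventually {i : ℕ} {c : Bool} {t : Term S X} (h : Col out i c t) :
    ∃ m, ∀ u, DeepClosure Q m u t → Col out i c u := by
  induction h with
  | ab h =>
    refine ⟨1, fun u hu => ?_⟩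
    rcases hzip hu with ⟨-, h'⟩ | ⟨l, u', t', h1, h2, -⟩
    · cases h.symm.trans h'
    · cases h.symm.trans h2
      exact .ab h1
  | f h _ ih =>
    obtain ⟨m, hm⟩ := ih
    refine ⟨m + 1, fun u hu => ?_⟩
    rcases hzip hu with ⟨-, h'⟩ | ⟨l, u', t', h1, h2, h3⟩
    · cases h.symm.trans h'
    · cases h.symm.trans h2
      exact .f h1 (hm _ h3)

/-- Terms near the limit share its prefix of letters f and every colour it has, but may have a
colour behind the prefix that the limit lacks. So their count is at least that of the limit. -/
theorem Cnt.eventually {i n : ℕ} {c : Bool} {t : Term S X} (h : Cnt out i c n t) :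
    ∃ m, ∀ u, DeepClosure Q m u t → ∃ n' ≥ n, Cnt out i c n' u := by
  induction h with
  | @ab t t' h =>
    by_cases hc : Col out i (!c) t'
    · obtain ⟨m, hm⟩ := hc.eventually hzip
      refine ⟨m + 1, fun u hu => ?_⟩
      rcases hzip hu with ⟨-, h'⟩ | ⟨l, u', t', h1, h2, h3⟩
      · cases h.symm.trans h'
      · cases h.symm.trans h2
        exact ⟨1, by split_ifs; all_goals simp, by simpa [hm _ h3] using Cnt.ab (i := i) (c := c) h1⟩
    · refine ⟨1, fun u hu => ?_⟩
      rcases hzip hu with ⟨-, h'⟩ | ⟨l, u', t', h1, h2, h3⟩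
      · cases h.symm.trans h'
      · cases h.symm.trans h2
        exact ⟨_, by simp [hc], .ab h1⟩
  | f h _ ih =>
    obtain ⟨m, hm⟩ := ih
    refine ⟨m + 1, fun u hu => ?_⟩
    rcases hzip hu with ⟨-, h'⟩ | ⟨l, u', t', h1, h2, h3⟩
    · cases h.symm.trans h'
    · cases h.symm.trans h2
      obtain ⟨n', hn', h4⟩ := hm _ h3
      exact ⟨n' + 1, by omega, .f h1 h4⟩

/-- A count `n` puts the coloured letter at depth at most `n`, out of reach of steps of depth `n +
1` or more. -/
theorem Cnt.col_limit {i n : ℕ} {c : Bool} {u t : Term S X} (h : Cnt out i c n u)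
    (hut : DeepClosure Q (n + 1) u t) : Col out (i + 1) c t := by
  induction h generalizing t with
  | ab h =>
    rcases hzip hut with ⟨h', -⟩ | ⟨l, u', t', h1, h2, -⟩
    · cases h.symm.trans h'
    · cases h.symm.trans h1
      exact .ab h2
  | f h _ ih =>
    rcases hzip hut with ⟨h', -⟩ | ⟨l, u', t', h1, h2, h3⟩
    · cases h.symm.trans h'
    · cases h.symm.trans h1
      exact .f h2 (ih h3)

/-- Counts along the sequence are bounded by that of `s`. A step depth beyond this bound freezes the
prefix, so the limit has a count; by semicontinuity it is at most the count of a nearby `u`, hence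
at most that of `s`. -/
theorem LimInv.of_limit {k : ℕ} {s t : Term S X}
    (h : ∀ m, ∃ u, LimInv out k s u ∧ DeepClosure Q m u t) : LimInv out k s t := by
  refine ⟨fun i c hi hc => ?_, fun i c n hi hn => ?_⟩
  · obtain ⟨m, hm⟩ := hc.eventually hzip
    obtain ⟨u, hsu, hut⟩ := h m
    exact hsu.col i c hi (hm u hut)
  · have hcol : Col out (i + 1) c t := by
      obtain ⟨u, hsu, hut⟩ := h (n + 1)
      obtain ⟨m, hmn, hm⟩ := hsu.cnt i c n hi hn
      exact hm.col_limit hzip (hut.mono_depth (by omega))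
    obtain ⟨n', hn'⟩ := hcol.exists_cnt
    obtain ⟨m, hm⟩ := hn'.eventually hzip
    obtain ⟨u, hsu, hut⟩ := h m
    obtain ⟨m', hm', h1⟩ := hm u hut
    obtain ⟨m'', hm'', h2⟩ := hsu.cnt i c n hi hn
    obtain rfl := h1.unique h2
    exact ⟨n', hm'.trans hm'', hn'⟩

variable {k : ℕ} (hlim : ∀ {n s t}, DeepClosure Q n s t → LimInv out k s t)
include hlim

/-- The colour inside `Cnt` has index `i ≥ k + 1`, where `col_succ_iff` gives an equivalence, and
the prefix of length at most `n` is untouched. -/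
theorem cnt_iff_of_deepClosure {i n : ℕ} {c : Bool} {u t : Term S X} (hi : k + 1 ≤ i)
    (h : DeepClosure Q (n + 1) u t) : Cnt out i c n u ↔ Cnt out i c n t := by
  obtain ⟨i, rfl⟩ := Nat.exists_eq_add_of_le' (Nat.one_le_of_lt hi)
  replace hi : k ≤ i := Nat.le_of_succ_le_succ hi
  induction n generalizing u t with
  | zero =>
    rcases hzip h with ⟨h1, h2⟩ | ⟨l, u', t', h1, h2, h3⟩
    · exact iff_of_false (not_cnt h1) (not_cnt h2)
    · rw [cnt_iff h1, cnt_iff h2, (hlim h3).col_succ_iff hi]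
      simp
  | succ n ih =>
    rcases hzip h with ⟨h1, h2⟩ | ⟨l, u', t', h1, h2, h3⟩
    · exact iff_of_false (not_cnt h1) (not_cnt h2)
    · rw [cnt_iff h1, cnt_iff h2, (hlim h3).col_succ_iff hi]
      simp only [Nat.add_right_cancel_iff, exists_eq_left', ih h3]

/-- A potential `n` allows at most `n` letters g, so the first indexed letter lies above all steps;
its colour condition is at `K ≥ k + 1`. -/
theorem low_iff_of_deepClosure {K n : ℕ} {u t : Term S X} (hK : k + 1 ≤ K)
    (h : DeepClosure Q (n + 1) u t) : Low out K n u ↔ Low out K n t := by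
  obtain ⟨K, rfl⟩ := Nat.exists_eq_add_of_le' (Nat.one_le_of_lt hK)
  replace hK : k ≤ K := Nat.le_of_succ_le_succ hK
  induction n generalizing u t with
  | zero =>
    rcases hzip h with ⟨h1, h2⟩ | ⟨l, u', t', h1, h2, h3⟩
    · exact iff_of_false (not_low h1) (not_low h2)
    · rw [low_iff h1, low_iff h2, (hlim h).col_succ_iff hK]
      simp
  | succ n ih =>
    rcases hzip h with ⟨h1, h2⟩ | ⟨l, u', t', h1, h2, h3⟩
    · exact iff_of_false (not_low h1) (not_low h2)
    · rw [low_iff h1, low_iff h2, (hlim h).col_succ_iff hK]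
      simp only [exists_eq_left', Nat.add_right_cancel_iff, ih h3]

theorem Inv.of_limit {s t : Term S X}
    (h : ∀ m, ∃ u, Inv out (k + 1) s u ∧ DeepClosure Q m u t) : Inv out (k + 1) s t := by
  refine ⟨fun i c hi => ?_, fun i c n hi => ?_, fun K n hK => ?_⟩
  · obtain ⟨u, hsu, hut⟩ := h 0
    obtain ⟨j, rfl⟩ := Nat.exists_eq_add_of_le' (Nat.one_le_of_lt hi)
    exact (hsu.col _ c hi).trans ((hlim hut).col_succ_iff (Nat.le_of_succ_le_succ hi))
  · obtain ⟨u, hsu, hut⟩ := h (n + 1)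
    exact (hsu.cnt i c n hi).trans (cnt_iff_of_deepClosure hzip hlim hi hut)
  · obtain ⟨u, hsu, hut⟩ := h (n + 1)
    exact (hsu.low K n hK).trans (low_iff_of_deepClosure hzip hlim hK hut)

end Limits

/-! ### Rules on words -/

variable (out)

/-- The term is read as the given finite word. -/
def Spell : List Letter → Term S X → Prop
  | [], t => out t = none
  | l :: ls, t => ∃ t', out t = some (l, t') ∧ Spell ls t'

/-- The rules of the system as rules on words. The rule `g → gg` comes from instances of the rule
for `g` in which the index is not a numeral. -/
inductive WordRule : List Letter → List Letter → Prop
  | gb (i : ℕ) : WordRule [.g, .ab false i] [.g, .g, .ab true (i + 1)]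
  | zero (c : Bool) : WordRule [.ab c 0] [.f 0, .ab c 0]
  | succ (c : Bool) (i : ℕ) : WordRule [.ab c (i + 1)] [.ab c (i + 1), .ab c i]
  | opp (c : Bool) (i : ℕ) : WordRule [.ab c (i + 1), .ab (!c) i] [.f (i + 1), .ab c (i + 1)]
  | gg : WordRule [.g] [.g, .g]
  | nil : WordRule [] []

variable {out}

theorem spell_nil {t : Term S X} : Spell out [] t ↔ out t = none := Iff.rfl

/-- The main cases: `opp` trades an opposite colour for one letter f, keeping the count; `succ` adds
a letter of the same colour, which is not counted; `gb` raises the number of letters g and the index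
by one each. -/
theorem Inv.of_wordRule {v w : List Letter} (h : WordRule v w) {s t : Term S X}
    (hs : Spell out v s) (ht : Spell out w t) : Inv out 0 s t := by
  cases h with
  | nil =>
    exact Inv.of_zip (Or.inl ⟨hs, ht⟩)
  | gg =>
    obtain ⟨s1, hs, hs1⟩ := hs
    obtain ⟨t1, ht, t2, ht1, ht2⟩ := ht
    rw [spell_nil] at hs1 ht2
    constructor <;> intros <;>
      simp [col_iff hs, cnt_iff hs, low_iff hs, col_iff ht, cnt_iff ht, low_iff ht, col_iff ht1,
        cnt_iff ht1, low_iff ht1, not_col hs1, not_cnt hs1, not_low hs1, not_low ht2, not_col ht2,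
        not_cnt ht2, Letter.HasIndex]
  | gb i =>
    obtain ⟨s1, hs, s2, hs1, hs2⟩ := hs
    obtain ⟨t1, ht, t2, ht1, t3, ht2, ht3⟩ := ht
    rw [spell_nil] at hs2 ht3
    constructor
    · intros
      simp [col_iff hs, col_iff ht]
    · intros
      simp [cnt_iff hs, cnt_iff ht]
    · intros
      simp [low_iff hs, low_iff ht, low_iff ht1, low_iff hs1, low_iff ht2, Letter.HasIndex,
        col_iff hs1, col_iff ht2]
      constructor
      · rintro ⟨m, rfl, h1, h2⟩
        -- The letter b lacks the colour required at `i = K`, so `i < K` and `m ≥ 1`.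
        exact ⟨m - 1, by omega, by omega⟩
      · rintro ⟨m, rfl, h1⟩
        exact ⟨m + 1, rfl, by omega, by omega⟩
  | zero c =>
    obtain ⟨s1, hs, hs1⟩ := hs
    obtain ⟨t1, ht, t2, ht1, ht2⟩ := ht
    rw [spell_nil] at hs1 ht2
    constructor
    · intros
      simp [col_iff hs, col_iff ht, col_iff ht1]
    · intros
      simp [cnt_iff hs, cnt_iff ht]
    · intros
      simp [low_iff hs, low_iff ht, Letter.HasIndex, col_iff hs, col_iff ht, col_iff ht1]
      tauto
  | succ c i =>
    obtain ⟨s1, hs, hs1⟩ := hs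
    obtain ⟨t1, ht, t2, ht1, ht2⟩ := ht
    rw [spell_nil] at hs1 ht2
    constructor
    · intros
      simp [col_iff hs, col_iff ht]
    · intros
      simp [cnt_iff hs, cnt_iff ht, not_col hs1, col_iff ht1]
      rintro rfl rfl
      simp
    · intros
      simp [low_iff hs, low_iff ht, Letter.HasIndex, col_iff hs, col_iff ht]
  | opp c i =>
    obtain ⟨s1, hs, s2, hs1, hs2⟩ := hs
    obtain ⟨t1, ht, t2, ht1, ht2⟩ := ht
    rw [spell_nil] at hs2 ht2
    constructor
    · intros
      simp [col_iff hs, col_iff ht, col_iff ht1]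
    · intros
      simp [cnt_iff hs, cnt_iff ht, cnt_iff ht1, not_col ht2, col_iff hs1]
      constructor
      · rintro ⟨⟨rfl, rfl⟩, h⟩
        simpa using h
      · rintro ⟨rfl, rfl, rfl, -⟩
        simp
    · intros
      simp [low_iff hs, low_iff ht, Letter.HasIndex, col_iff hs, col_iff ht, col_iff ht1]
      tauto

/-! ### Invariants of the levels of `SE` -/

/-- A reading is suitable for a system if root steps are read as instances of the rules on words,
and the first letter and the position of the rest do not depend on the arguments up to `=^∞`. -/
structure Suitable (out : Reading S X) (R : TRS S X) : Prop where
  rootStep : ∀ {s t}, R.rootStep s t → ∃ v w, WordRule v w ∧ Spell out v s ∧ Spell out w t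
  node : ∀ f ss ts, (∀ i, R.ieq (ss i) (ts i)) →
    (out (node f ss) = none ∧ out (node f ts) = none) ∨
      ∃ l i, out (node f ss) = some (l, ss i) ∧ out (node f ts) = some (l, ts i)

namespace Suitable

variable {R : TRS S X} (hR : Suitable out R)
include hR

theorem zip {P : TRel S X} (hP : P ≤ R.ieq) (hrefl : ∀ s, P s s) {s t : Term S X}
    (h : Lift P s t) : Zip out P s t := by
  cases h with
  | node f ss ts hi =>
    rcases hR.node f ss ts fun i => hP _ _ (hi i) with h | ⟨l, i, h1, h2⟩
    · exact Or.inl h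
    · exact Or.inr ⟨l, _, _, h1, h2, hi i⟩
  | refl =>
    rcases h : out s with _ | ⟨l, s'⟩
    · exact Or.inl ⟨h, h⟩
    · exact Or.inr ⟨l, s', s', h, h, hrefl s'⟩

theorem inv_of_stepAt {Q : TRel S X} {k : ℕ} (hQ : Q ≤ R.ieq) (hQ' : Q ≤ Inv out k)
    {p : List ℕ} {s t : Term S X} (h : StepAt Q p s t) : Inv out k s t := by
  refine (StepAt.of_lift_le (P := R.ieq ⊓ Inv out k) (le_inf hQ hQ')
    (fun s => ⟨TRS.ieq_refl s, Inv.refl s⟩) (fun h => ⟨?_, ?_⟩) h).2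
  · exact TRS.ieq_of_lift (h.mono inf_le_left)
  · have := hR.zip inf_le_left (fun s => ⟨TRS.ieq_refl s, Inv.refl s⟩) h
    refine Inv.of_zip (this.imp_right ?_)
    rintro ⟨l, s', t', h1, h2, h3⟩
    exact ⟨l, s', t', h1, h2, h3.2⟩

/-- Two passes over the sequences: the first gives `LimInv` at `k`, and this supplies the
equivalences needed to pass `Inv` at `k + 1` to limits in the second. -/
theorem inv_strongClosure {Q : TRel S X} {k : ℕ} (hQ : Q ≤ R.ieq) (hQ' : Q ≤ Inv out k) :
    strongClosure Q ≤ Inv out (k + 1) := by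
  have hzip : ∀ {n s t}, DeepClosure Q (n + 1) s t → Zip out (DeepClosure Q n) s t :=
    fun h => hR.zip (TRS.deepClosure_le_ieq hQ) DeepClosure.refl h.lift
  have hstep : ∀ {p s t}, StepAt Q p s t → Inv out k s t := hR.inv_of_stepAt hQ hQ'
  have hlim : ∀ {n s t}, DeepClosure Q n s t → LimInv out k s t := fun {n s t} h =>
    DeepClosure.induction LimInv.refl LimInv.trans (fun h => (hstep h).limInv)
      (LimInv.of_limit hzip) s t h
  exact strongClosure_le_deepClosure.trans (DeepClosure.induction Inv.refl Inv.trans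
    (fun h => (hstep h).mono (Nat.le_succ k)) (Inv.of_limit hzip hlim))

theorem inv_iterate (k : ℕ) :
    (fun P : TRel S X => strongClosure (equivClosure P))^[k] R.step ≤ Inv out k := by
  induction k with
  | zero =>
    rintro s t ⟨p, h⟩
    refine hR.inv_of_stepAt (fun _ _ => TRS.ieq_of_rootStep) ?_ h
    intro s t h
    obtain ⟨v, w, hvw, hs, ht⟩ := hR.rootStep h
    exact Inv.of_wordRule hvw hs ht
  | succ k ih =>
    rw [Function.iterate_succ_apply']
    refine hR.inv_strongClosure (TRS.equivClosure_le_ieq (TRS.iterate_le_ieq k)) ?_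
    intro s t h
    induction h with
    | rel _ _ h => exact ih _ _ h
    | refl => exact Inv.refl _
    | symm _ _ _ ih => exact ih.symm
    | trans _ _ _ _ _ ih1 ih2 => exact ih1.trans ih2

/-- A term read as `g a₀` is not in relation `S_E` to a term read as `g g g …`. -/
theorem not_SE {s t : Term S X} (hs : Spell out [.g, .ab true 0] s)
    (ht : out t = some (.g, t)) : ¬ SE R.step s t := by
  rintro ⟨k, h⟩
  obtain ⟨s1, hs, s2, hs1, -⟩ := hs
  have hlow : ∀ n, ¬ Low out k n t := by
    intro n
    induction n with
    | zero => rw [low_iff ht]; simp [Letter.HasIndex]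
    | succ n ih => rw [low_iff ht]; simp [Letter.HasIndex, ih]
  -- In g a₀ there is one g and the index is 0, so for `K = k` the potential is `1 + k - 0`. The
  -- colour condition applies only if `k = 0`.
  refine hlow (k + 1) (((hR.inv_iterate k _ _ h).low k (k + 1) le_rfl).1 (.g hs (.base hs1 rfl
    rfl ?_)))
  rintro rfl
  exact .ab hs1

end Suitable
end Reading

/-! ### Derivation of the equation with g^ω -/

/-- The function is an application of a symbol in one of its arguments. -/
def IsArg (φ : Term S X → Term S X) : Prop :=
  ∀ P : TRel S X, (∀ s, P s s) → ∀ s t, P s t → Lift P (φ s) (φ t)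

theorem IsArg.ieq {R : TRS S X} {φ : Term S X → Term S X} (h : IsArg φ) {s t : Term S X}
    (hst : R.ieq s t) : R.ieq (φ s) (φ t) :=
  TRS.ieq_of_lift (h _ TRS.ieq_refl _ _ hst)

/-- Both terms unfold to the same infinite iterate of `φ`. -/
theorem TRS.ieq_of_unfold {R : TRS S X} {φ : Term S X → Term S X} (h : IsArg φ) {s t : Term S X}
    (hs : R.ieq s (φ s)) (ht : R.ieq t (φ t)) : R.ieq s t := by
  refine ieq_coinduction (P := fun a b => a = s ∧ b = t) ?_ s t ⟨rfl, rfl⟩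
  rintro _ _ ⟨rfl, rfl⟩
  exact ⟨_, _, hs, h _ (fun _ => Or.inr (ieq_refl _)) _ _ (Or.inl ⟨rfl, rfl⟩), ieq_symm ht⟩

theorem TRS.ieq_omega_of_rules {R : TRS S X} {A B : ℕ → Term S X}
    {a b f : ℕ → Term S X → Term S X} {g : Term S X → Term S X} {om : Term S X}
    (ha : ∀ i, IsArg (a i)) (hb : ∀ i, IsArg (b i)) (hf : ∀ i, IsArg (f i)) (hg : IsArg g)
    (hom : om = g om) (gb : ∀ i, R.ieq (g (B i)) (g (g (A (i + 1)))))
    (a_zero : R.ieq (A 0) (f 0 (A 0))) (b_zero : R.ieq (B 0) (f 0 (B 0)))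
    (a_succ : ∀ i, R.ieq (A (i + 1)) (a (i + 1) (A i)))
    (b_succ : ∀ i, R.ieq (B (i + 1)) (b (i + 1) (B i)))
    (ab : ∀ i, R.ieq (a (i + 1) (B i)) (f (i + 1) (A (i + 1))))
    (ba : ∀ i, R.ieq (b (i + 1) (A i)) (f (i + 1) (B (i + 1)))) : R.ieq (g (A 0)) om := by
  have hAB : ∀ i, R.ieq (A i) (B i) := by
    intro i
    induction i with
    | zero => exact ieq_of_unfold (hf 0) a_zero b_zero
    | succ i ih =>
      exact ieq_of_unfold (hf (i + 1))
        (ieq_trans (a_succ i) (ieq_trans ((ha _).ieq ih) (ab i)))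
        (ieq_trans (b_succ i) (ieq_trans ((hb _).ieq (ieq_symm ih)) (ba i)))
  refine ieq_coinduction (P := fun s t => t = om ∧ ∃ i, s = g (A i)) ?_ _ _ ⟨rfl, 0, rfl⟩
  rintro _ t ⟨ht, i, rfl⟩
  refine ⟨_, g om, ieq_trans (hg.ieq (hAB i)) (gb i), ?_, ?_⟩
  · exact hg _ (fun _ => Or.inr (ieq_refl _)) _ om (Or.inl ⟨rfl, i + 1, rfl⟩)
  · rw [← hom, ht]
    exact ieq_refl _

theorem TRS.SE_lt_ieq {R : TRS S X} {s t : Term S X} (h : R.ieq s t) (h' : ¬ SE R.step s t) :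
    SE R.step < R.ieq :=
  lt_of_le_not_ge SE_le_ieq fun hle => h' (hle _ _ h)

theorem isArg_node (f : S.Sym) (c : Term S X → Fin (S.arity f) → Term S X)
    (h : ∀ i, (∀ s t, c s i = c t i) ∨ ∀ s, c s i = s) : IsArg fun t => node f (c t) := by
  intro P hP s t hst
  refine Lift.node f _ _ fun i => ?_
  rcases h i with h | h
  · rw [h s t]
    exact hP _
  · rwa [h s, h t]

/-! ### The infinite system -/

namespace Inf

theorem subst_g (σ : X → Term infSig X) (t) : (g t).subst σ = g (t.subst σ) :=
  (subst_node _ _ _).trans (congrArg _ (funext (Fin.forall_fin_one.2 rfl)))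

theorem subst_a (σ : X → Term infSig X) (i t) : (a i t).subst σ = a i (t.subst σ) :=
  (subst_node _ _ _).trans (congrArg _ (funext (Fin.forall_fin_one.2 rfl)))

theorem subst_b (σ : X → Term infSig X) (i t) : (b i t).subst σ = b i (t.subst σ) :=
  (subst_node _ _ _).trans (congrArg _ (funext (Fin.forall_fin_one.2 rfl)))

theorem subst_f (σ : X → Term infSig X) (i t) : (f i t).subst σ = f i (t.subst σ) :=
  (subst_node _ _ _).trans (congrArg _ (funext (Fin.forall_fin_one.2 rfl)))

theorem subst_eps (σ : X → Term infSig X) : (eps : Term infSig X).subst σ = eps :=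
  (subst_node _ _ _).trans (congrArg _ (funext fun i => Fin.elim0 i))

/-- The rules are closed terms, so substitutions do not change them. -/
theorem rootStep_iff {s t : Term infSig X} : (sys X).rootStep s t ↔ Rule s t := by
  have hsub : ∀ σ {l r : Term infSig X}, Rule l r → l.subst σ = l ∧ r.subst σ = r := by
    intro σ l r h
    cases h <;> simp only [subst_g, subst_a, subst_b, subst_f, subst_eps, and_self]
  constructor
  · rintro ⟨⟨l, r⟩, h, σ, rfl, rfl⟩
    obtain ⟨h1, h2⟩ := hsub σ h
    dsimp only
    rw [h1, h2]
    exact h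
  · intro h
    obtain ⟨h1, h2⟩ := hsub var h
    exact ⟨(s, t), h, var, h1.symm, h2.symm⟩

/-- The reading of a term over unary symbols as a word. -/
def reading : Reading infSig X := fun t =>
  match t.dest with
  | ⟨.inr .g, ts⟩ => some (.g, ts (0 : Fin 1))
  | ⟨.inr (.a i), ts⟩ => some (.ab true i, ts (0 : Fin 1))
  | ⟨.inr (.b i), ts⟩ => some (.ab false i, ts (0 : Fin 1))
  | ⟨.inr (.f i), ts⟩ => some (.f i, ts (0 : Fin 1))
  | ⟨.inr .eps, _⟩ => none
  | ⟨.inl _, _⟩ => none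

theorem suitable_reading : Reading.Suitable reading (sys X) where
  rootStep h := by
    rw [rootStep_iff] at h
    cases h with
    | gb i => exact ⟨_, _, .gb i, ⟨_, rfl, _, rfl, rfl⟩, ⟨_, rfl, _, rfl, _, rfl, rfl⟩⟩
    | a_zero => exact ⟨_, _, .zero true, ⟨_, rfl, rfl⟩, ⟨_, rfl, _, rfl, rfl⟩⟩
    | b_zero => exact ⟨_, _, .zero false, ⟨_, rfl, rfl⟩, ⟨_, rfl, _, rfl, rfl⟩⟩
    | a_succ i => exact ⟨_, _, .succ true i, ⟨_, rfl, rfl⟩, ⟨_, rfl, _, rfl, rfl⟩⟩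
    | b_succ i => exact ⟨_, _, .succ false i, ⟨_, rfl, rfl⟩, ⟨_, rfl, _, rfl, rfl⟩⟩
    | ab i => exact ⟨_, _, .opp true i, ⟨_, rfl, _, rfl, rfl⟩, ⟨_, rfl, _, rfl, rfl⟩⟩
    | ba i => exact ⟨_, _, .opp false i, ⟨_, rfl, _, rfl, rfl⟩, ⟨_, rfl, _, rfl, rfl⟩⟩
  node f ss ts _ := by
    cases f with
    | eps => exact Or.inl ⟨rfl, rfl⟩
    | _ => exact Or.inr ⟨_, (0 : Fin 1), rfl, rfl⟩

theorem not_SE : ¬ SE (sys X).step (g (a 0 eps)) gOmega :=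
  suitable_reading.not_SE ⟨_, rfl, _, rfl, rfl⟩ (by
    conv_lhs => rw [gOmega, omega_eq]
    rfl)

theorem ieq_gOmega : (sys X).ieq (g (a 0 eps)) gOmega := by
  have rule : ∀ {s t : Term infSig X}, Rule s t → (sys X).ieq s t := fun h =>
    TRS.ieq_of_rootStep (rootStep_iff.2 h)
  exact TRS.ieq_omega_of_rules (A := fun i => a i eps) (B := fun i => b i eps) (a := a) (b := b)
    (f := f) (g := g)
    (fun i => isArg_node (S := infSig) (.a i) (fun t => ![t]) (Fin.forall_fin_one.2 (Or.inr fun _ => rfl)))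
    (fun i => isArg_node (S := infSig) (.b i) (fun t => ![t]) (Fin.forall_fin_one.2 (Or.inr fun _ => rfl)))
    (fun i => isArg_node (S := infSig) (.f i) (fun t => ![t]) (Fin.forall_fin_one.2 (Or.inr fun _ => rfl)))
    (isArg_node (S := infSig) .g (fun t => ![t]) (Fin.forall_fin_one.2 (Or.inr fun _ => rfl)))
    ((omega_eq _).trans (congrArg _ (funext (Fin.forall_fin_one.2 rfl))))
    (fun i => rule (.gb i)) (rule .a_zero) (rule .b_zero) (fun i => rule (.a_succ i))
    (fun i => rule (.b_succ i)) (fun i => rule (.ab i)) (fun i => rule (.ba i))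

end Inf

/-! ### The finite system -/

namespace Fini

theorem subst_g (σ : X → Term finSig X) (t) : (g t).subst σ = g (t.subst σ) :=
  (subst_node _ _ _).trans (congrArg _ (funext (Fin.forall_fin_one.2 rfl)))

theorem subst_s (σ : X → Term finSig X) (t) : (s t).subst σ = s (t.subst σ) :=
  (subst_node _ _ _).trans (congrArg _ (funext (Fin.forall_fin_one.2 rfl)))

theorem subst_a (σ : X → Term finSig X) (n t) : (a n t).subst σ = a (n.subst σ) (t.subst σ) :=
  (subst_node _ _ _).trans (congrArg _ (funext (Fin.forall_fin_two.2 ⟨rfl, rfl⟩)))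

theorem subst_b (σ : X → Term finSig X) (n t) : (b n t).subst σ = b (n.subst σ) (t.subst σ) :=
  (subst_node _ _ _).trans (congrArg _ (funext (Fin.forall_fin_two.2 ⟨rfl, rfl⟩)))

theorem subst_f (σ : X → Term finSig X) (n t) : (f n t).subst σ = f (n.subst σ) (t.subst σ) :=
  (subst_node _ _ _).trans (congrArg _ (funext (Fin.forall_fin_two.2 ⟨rfl, rfl⟩)))

theorem subst_eps (σ : X → Term finSig X) : (eps : Term finSig X).subst σ = eps :=
  (subst_node _ _ _).trans (congrArg _ (funext fun i => Fin.elim0 i))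

theorem subst_zero (σ : X → Term finSig X) : (zero : Term finSig X).subst σ = zero :=
  (subst_node _ _ _).trans (congrArg _ (funext fun i => Fin.elim0 i))

/-- The rules with a term `n` in place of the variable. -/
inductive Instance (n : Term finSig X) : Term finSig X → Term finSig X → Prop
  | gb : Instance n (g (b n eps)) (g (g (a (s n) eps)))
  | a_zero : Instance n (a zero eps) (f zero (a zero eps))
  | b_zero : Instance n (b zero eps) (f zero (b zero eps))
  | a_succ : Instance n (a (s n) eps) (a (s n) (a n eps))
  | b_succ : Instance n (b (s n) eps) (b (s n) (b n eps))
  | ab : Instance n (a (s n) (b n eps)) (f (s n) (a (s n) eps))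
  | ba : Instance n (b (s n) (a n eps)) (f (s n) (b (s n) eps))

theorem rootStep_iff {x : X} {t u : Term finSig X} :
    (sys x).rootStep t u ↔ ∃ n, Instance n t u := by
  constructor
  · rintro ⟨⟨l, r⟩, h, σ, rfl, rfl⟩
    refine ⟨σ x, ?_⟩
    change Rule x l r at h
    cases h <;> simp only [subst_g, subst_a, subst_b, subst_f, subst_s, subst_eps, subst_zero,
      subst_var] <;> constructor
  · rintro ⟨n, h⟩
    have hr : ∀ {l r : Term finSig X}, Rule x l r →
        (sys x).rootStep (l.subst fun _ => n) (r.subst fun _ => n) :=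
      fun {l r} h => ⟨(l, r), h, _, rfl, rfl⟩
    cases h
    · simpa only [subst_g, subst_a, subst_b, subst_f, subst_s, subst_eps, subst_zero,
        subst_var] using hr .gb
    · simpa only [subst_g, subst_a, subst_b, subst_f, subst_s, subst_eps, subst_zero,
        subst_var] using hr .a_zero
    · simpa only [subst_g, subst_a, subst_b, subst_f, subst_s, subst_eps, subst_zero,
        subst_var] using hr .b_zero
    · simpa only [subst_g, subst_a, subst_b, subst_f, subst_s, subst_eps, subst_zero,
        subst_var] using hr .a_succ
    · simpa only [subst_g, subst_a, subst_b, subst_f, subst_s, subst_eps, subst_zero,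
        subst_var] using hr .b_succ
    · simpa only [subst_g, subst_a, subst_b, subst_f, subst_s, subst_eps, subst_zero,
        subst_var] using hr .ab
    · simpa only [subst_g, subst_a, subst_b, subst_f, subst_s, subst_eps, subst_zero,
        subst_var] using hr .ba

/-- The numeral `sⁱ(0)`. -/
def numeral : ℕ → Term finSig X
  | 0 => zero
  | i + 1 => s (numeral i)

theorem s_inj {t u : Term finSig X} (h : s t = s u) : t = u :=
  congrFun (node_inj h) (0 : Fin 1)

theorem s_ne_zero {t : Term finSig X} : s t ≠ zero := fun h =>
  FinSym.noConfusion (node_sym_inj (S := finSig) h)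

theorem numeral_injective : Function.Injective (numeral : ℕ → Term finSig X) := by
  intro i j h
  induction i generalizing j with
  | zero =>
    cases j with
    | zero => rfl
    | succ j => exact absurd h.symm s_ne_zero
  | succ i ih =>
    cases j with
    | zero => exact absurd h s_ne_zero
    | succ j => rw [ih (s_inj h)]

/-- The head of the term is none of the symbols `s` and `0`. -/
def NotConstructor (t : Term finSig X) : Prop := t ≠ zero ∧ ∀ u, t ≠ s u

theorem Instance.notConstructor {n t u : Term finSig X} (h : Instance n t u) :
    NotConstructor t ∧ NotConstructor u := by
  cases h <;> refine ⟨⟨?_, fun _ => ?_⟩, ⟨?_, fun _ => ?_⟩⟩ <;>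
    exact fun h => FinSym.noConfusion (node_sym_inj (S := finSig) h)

/-- No side of an instance of a rule has root s or 0, so only lifted steps apply to a numeral; they
act on a smaller numeral. -/
theorem eq_numeral_of_ieq {x : X} {i : ℕ} {t : Term finSig X} (h : (sys x).ieq (numeral i) t) :
    t = numeral i := by
  induction i generalizing t with
  | zero =>
    rw [← TRS.ieqOp_ieq] at h
    induction h with
    | refl => rfl
    | tail _ h ih =>
      subst ih
      rcases h with h | h | h
      · obtain ⟨n, h⟩ := rootStep_iff.1 h
        exact absurd rfl h.notConstructor.2.1
      · obtain ⟨n, h⟩ := rootStep_iff.1 h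
        exact absurd rfl h.notConstructor.1.1
      · generalize hz : (numeral 0 : Term finSig X) = z at h
        cases h with
        | refl => rfl
        | node _ ss ts hi =>
          obtain rfl := node_sym_inj hz
          exact congrArg _ (funext fun i => Fin.elim0 i)
  | succ i ihi =>
    rw [← TRS.ieqOp_ieq] at h
    induction h with
    | refl => rfl
    | tail _ h ih =>
      subst ih
      rcases h with h | h | h
      · obtain ⟨n, h⟩ := rootStep_iff.1 h
        exact absurd rfl (h.notConstructor.2.2 (numeral i))
      · obtain ⟨n, h⟩ := rootStep_iff.1 h
        exact absurd rfl (h.notConstructor.1.2 (numeral i))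
      · generalize hz : (numeral (i + 1) : Term finSig X) = z at h
        cases h with
        | refl => rfl
        | node _ ss ts hi =>
          obtain rfl := node_sym_inj hz
          have h0 := congrFun (node_inj hz) (0 : Fin 1)
          have h1 := hi (0 : Fin 1)
          rw [← h0] at h1
          exact congrArg _ (funext (Fin.forall_fin_one.2 ((ihi h1).trans h0)))

open Classical in
/-- The letter given by a term for the index, if it is a numeral, before the rest `t`. -/
noncomputable def indexed (l : ℕ → Letter) (n t : Term finSig X) : Option (Letter × Term finSig X) :=
  if h : ∃ i, n = numeral i then some (l h.choose, t) else none

theorem indexed_numeral (l : ℕ → Letter) (i : ℕ) (t : Term finSig X) :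
    indexed l (numeral i) t = some (l i, t) := by
  have h : ∃ j, (numeral i : Term finSig X) = numeral j := ⟨i, rfl⟩
  rw [indexed, dif_pos h, ← numeral_injective h.choose_spec]

theorem indexed_of_not {l : ℕ → Letter} {n t : Term finSig X} (h : ¬ ∃ i, n = numeral i) :
    indexed l n t = none := dif_neg h

/-- The reading of a term as a word in which the first arguments of `a`, `b`, `f` are indices. -/
noncomputable def reading : Reading finSig X := fun t =>
  match t.dest with
  | ⟨.inr .g, ts⟩ => some (.g, ts (0 : Fin 1))
  | ⟨.inr .a, ts⟩ => indexed (.ab true) (ts (0 : Fin 2)) (ts (1 : Fin 2))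
  | ⟨.inr .b, ts⟩ => indexed (.ab false) (ts (0 : Fin 2)) (ts (1 : Fin 2))
  | ⟨.inr .f, ts⟩ => indexed .f (ts (0 : Fin 2)) (ts (1 : Fin 2))
  | ⟨.inr .s, _⟩ => none
  | ⟨.inr .zero, _⟩ => none
  | ⟨.inr .eps, _⟩ => none
  | ⟨.inl _, _⟩ => none

theorem reading_a_numeral (i : ℕ) (t : Term finSig X) :
    reading (a (numeral i) t) = some (.ab true i, t) := indexed_numeral _ i t

theorem reading_b_numeral (i : ℕ) (t : Term finSig X) :
    reading (b (numeral i) t) = some (.ab false i, t) := indexed_numeral _ i t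

theorem reading_f_numeral (i : ℕ) (t : Term finSig X) :
    reading (f (numeral i) t) = some (.f i, t) := indexed_numeral _ i t

theorem indexed_ieq {x : X} (l : ℕ → Letter) {m n t u : Term finSig X} (h : (sys x).ieq m n) :
    (indexed l m t = none ∧ indexed l n u = none) ∨
      ∃ l', indexed l m t = some (l', t) ∧ indexed l n u = some (l', u) := by
  by_cases hm : ∃ i, m = numeral i
  · obtain ⟨i, rfl⟩ := hm
    rw [eq_numeral_of_ieq h, indexed_numeral, indexed_numeral]
    exact Or.inr ⟨_, rfl, rfl⟩
  · refine Or.inl ⟨indexed_of_not hm, indexed_of_not ?_⟩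
    rintro ⟨i, rfl⟩
    exact hm ⟨i, eq_numeral_of_ieq (TRS.ieq_symm h)⟩

open Reading in
theorem suitable_reading (x : X) : Reading.Suitable reading (sys x) where
  rootStep h := by
    obtain ⟨n, h⟩ := rootStep_iff.1 h
    by_cases hn : ∃ i, n = numeral i
    · obtain ⟨i, rfl⟩ := hn
      have ha := reading_a_numeral (X := X)
      have hb := reading_b_numeral (X := X)
      have hf := reading_f_numeral (X := X)
      cases h with
      | gb => exact ⟨_, _, .gb i, ⟨_, rfl, _, hb i _, rfl⟩, ⟨_, rfl, _, rfl, _, ha (i + 1) _, rfl⟩⟩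
      | a_zero => exact ⟨_, _, .zero true, ⟨_, ha 0 _, rfl⟩, ⟨_, hf 0 _, _, ha 0 _, rfl⟩⟩
      | b_zero => exact ⟨_, _, .zero false, ⟨_, hb 0 _, rfl⟩, ⟨_, hf 0 _, _, hb 0 _, rfl⟩⟩
      | a_succ =>
        exact ⟨_, _, .succ true i, ⟨_, ha (i + 1) _, rfl⟩, ⟨_, ha (i + 1) _, _, ha i _, rfl⟩⟩
      | b_succ =>
        exact ⟨_, _, .succ false i, ⟨_, hb (i + 1) _, rfl⟩, ⟨_, hb (i + 1) _, _, hb i _, rfl⟩⟩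
      | ab =>
        exact ⟨_, _, .opp true i, ⟨_, ha (i + 1) _, _, hb i _, rfl⟩,
          ⟨_, hf (i + 1) _, _, ha (i + 1) _, rfl⟩⟩
      | ba =>
        exact ⟨_, _, .opp false i, ⟨_, hb (i + 1) _, _, ha i _, rfl⟩,
          ⟨_, hf (i + 1) _, _, hb (i + 1) _, rfl⟩⟩
    -- With a first argument that is no numeral, the words end at this symbol: the rule for g
    -- becomes g → g g, the rules for 0 are unaffected, and the others relate empty words.
    · have hs : ¬ ∃ i, s n = numeral i := by
        rintro ⟨_ | i, hi⟩
        · exact s_ne_zero hi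
        · exact hn ⟨i, s_inj hi⟩
      have ha := reading_a_numeral (X := X)
      have hb := reading_b_numeral (X := X)
      have hf := reading_f_numeral (X := X)
      cases h with
      | gb => exact ⟨_, _, .gg, ⟨_, rfl, indexed_of_not hn⟩, ⟨_, rfl, _, rfl, indexed_of_not hs⟩⟩
      | a_zero => exact ⟨_, _, .zero true, ⟨_, ha 0 _, rfl⟩, ⟨_, hf 0 _, _, ha 0 _, rfl⟩⟩
      | b_zero => exact ⟨_, _, .zero false, ⟨_, hb 0 _, rfl⟩, ⟨_, hf 0 _, _, hb 0 _, rfl⟩⟩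
      | _ => exact ⟨_, _, .nil, indexed_of_not hs, indexed_of_not hs⟩
  node φ ss ts h := by
    cases φ with
    | g => exact Or.inr ⟨_, (0 : Fin 1), rfl, rfl⟩
    | a => exact (indexed_ieq _ (h (0 : Fin 2))).imp_right fun ⟨l, hl⟩ => ⟨l, (1 : Fin 2), hl⟩
    | b => exact (indexed_ieq _ (h (0 : Fin 2))).imp_right fun ⟨l, hl⟩ => ⟨l, (1 : Fin 2), hl⟩
    | f => exact (indexed_ieq _ (h (0 : Fin 2))).imp_right fun ⟨l, hl⟩ => ⟨l, (1 : Fin 2), hl⟩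
    | _ => exact Or.inl ⟨rfl, rfl⟩

theorem not_SE (x : X) : ¬ SE (sys x).step (g (a zero eps)) gOmega :=
  (suitable_reading x).not_SE ⟨_, rfl, _, reading_a_numeral 0 _, rfl⟩ (by
    conv_lhs => rw [gOmega, omega_eq]
    rfl)

theorem ieq_gOmega (x : X) : (sys x).ieq (g (a zero eps)) gOmega := by
  have rule : ∀ n {t u : Term finSig X}, Instance n t u → (sys x).ieq t u := fun n _ _ h =>
    TRS.ieq_of_rootStep (rootStep_iff.2 ⟨n, h⟩)
  exact TRS.ieq_omega_of_rules (A := fun i => a (numeral i) eps) (B := fun i => b (numeral i) eps)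
    (a := fun i => a (numeral i)) (b := fun i => b (numeral i)) (f := fun i => f (numeral i)) (g := g)
    (fun i => isArg_node (S := finSig) .a (fun t => ![numeral i, t])
      (Fin.forall_fin_two.2 ⟨Or.inl fun _ _ => rfl, Or.inr fun _ => rfl⟩))
    (fun i => isArg_node (S := finSig) .b (fun t => ![numeral i, t])
      (Fin.forall_fin_two.2 ⟨Or.inl fun _ _ => rfl, Or.inr fun _ => rfl⟩))
    (fun i => isArg_node (S := finSig) .f (fun t => ![numeral i, t])
      (Fin.forall_fin_two.2 ⟨Or.inl fun _ _ => rfl, Or.inr fun _ => rfl⟩))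
    (isArg_node (S := finSig) .g (fun t => ![t]) (Fin.forall_fin_one.2 (Or.inr fun _ => rfl)))
    ((omega_eq _).trans (congrArg _ (funext (Fin.forall_fin_one.2 rfl))))
    (fun i => rule (numeral i) .gb) (rule zero .a_zero) (rule zero .b_zero)
    (fun i => rule (numeral i) .a_succ) (fun i => rule (numeral i) .b_succ)
    (fun i => rule (numeral i) .ab) (fun i => rule (numeral i) .ba)

theorem finite_rules (x : X) : (sys x).rules.Finite := by
  have : {ρ : Term finSig X × Term finSig X | Rule x ρ.1 ρ.2} ⊆
      {(g (b (var x) eps), g (g (a (s (var x)) eps))),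
        (a zero eps, f zero (a zero eps)), (b zero eps, f zero (b zero eps)),
        (a (s (var x)) eps, a (s (var x)) (a (var x) eps)),
        (b (s (var x)) eps, b (s (var x)) (b (var x) eps)),
        (a (s (var x)) (b (var x) eps), f (s (var x)) (a (s (var x)) eps)),
        (b (s (var x)) (a (var x) eps), f (s (var x)) (b (s (var x)) eps))} := by
    rintro ⟨l, r⟩ h
    change Rule x l r at h
    cases h <;> simp only [Set.mem_insert_iff, Set.mem_singleton_iff, true_or, or_true]
  exact Set.Finite.subset (by simp only [Set.finite_insert, Set.finite_singleton]) this

theorem finite_sym : Finite finSig.Sym := by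
  refine Finite.of_surjective
    (![.g, .a, .b, .f, .s, .zero, .eps] : Fin 7 → FinSym) fun φ => ?_
  cases φ
  · exact ⟨0, rfl⟩
  · exact ⟨1, rfl⟩
  · exact ⟨2, rfl⟩
  · exact ⟨3, rfl⟩
  · exact ⟨4, rfl⟩
  · exact ⟨5, rfl⟩
  · exact ⟨6, rfl⟩

end Fini

end InfTRS

theorem mainTheorem5 :
    -- the inclusion, for every term rewriting system
    (∀ (S : InfTRS.Signature.{u}) (X : Type v) [Infinite X] (R : InfTRS.TRS S X),
      ∀ s t : InfTRS.Term S X, InfTRS.SE R.step s t → R.ieq s t) ∧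
    -- the infinite system: the inclusion is strict, as `g(a₀(ε))` and `g^ω` show
    (∀ (X : Type v) [Infinite X],
      InfTRS.SE (InfTRS.Inf.sys X).step < (InfTRS.Inf.sys X).ieq ∧
      (InfTRS.Inf.sys X).ieq
        (InfTRS.Inf.g (InfTRS.Inf.a 0 InfTRS.Inf.eps)) InfTRS.Inf.gOmega ∧
      ¬ InfTRS.SE (InfTRS.Inf.sys X).step
        (InfTRS.Inf.g (InfTRS.Inf.a 0 InfTRS.Inf.eps)) InfTRS.Inf.gOmega) ∧
    -- the finite system: the same with `g(a(0, ε))`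
    Finite InfTRS.finSig.Sym ∧
    (∀ (X : Type v) [Infinite X] (x : X),
      (InfTRS.Fini.sys x).rules.Finite ∧
      InfTRS.SE (InfTRS.Fini.sys x).step < (InfTRS.Fini.sys x).ieq ∧
      (InfTRS.Fini.sys x).ieq
        (InfTRS.Fini.g (InfTRS.Fini.a InfTRS.Fini.zero InfTRS.Fini.eps)) InfTRS.Fini.gOmega ∧
      ¬ InfTRS.SE (InfTRS.Fini.sys x).step
        (InfTRS.Fini.g (InfTRS.Fini.a InfTRS.Fini.zero InfTRS.Fini.eps)) InfTRS.Fini.gOmega) := by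
  refine ⟨fun S X _ R s t h => InfTRS.TRS.SE_le_ieq s t h, fun X _ => ?_,
    InfTRS.Fini.finite_sym, fun X _ x => ?_⟩
  · have h := InfTRS.Inf.ieq_gOmega (X := X)
    have h' := InfTRS.Inf.not_SE (X := X)
    exact ⟨InfTRS.TRS.SE_lt_ieq h h', h, h'⟩
  · have h := InfTRS.Fini.ieq_gOmega x
    have h' := InfTRS.Fini.not_SE x
    exact ⟨InfTRS.Fini.finite_rules x, InfTRS.TRS.SE_lt_ieq h h', h, h'⟩
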